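/- Theorem 5.2. Let $\Bbbk=\mathbb R$ or $\mathbb C$, let $\mathcal Q=(\mathcal Q_0,\mathcal Q_1,\mathfrak s,\mathfrak t)$ be a quiver with finite nonempty vertex set, and let $A=\Bbbk\mathcal Q/\mathcal I\neq 0$ be a finite-dimensional gentle algebra: paths are written $a_1\cdots a_l$ with $\mathfrak t(a_i)=\mathfrak s(a_{i+1})$; at most two arrows start and at most two arrows end at each vertex; if $\alpha_1\ne\alpha_2$ and $\mathfrak t(\alpha_1)=\mathfrak t(\alpha_2)=\mathfrak s(\beta)$, then exactly one of $\alpha_1\beta,\alpha_2\beta$ lies in $\mathcal I$; if $\beta_1\neq\beta_2$ and $\mathfrak t(\alpha)=\mathfrak s(\beta_1)=\mathfrak s(\beta_2)$, then exactly one of $\alpha\beta_1,\alpha\beta_2$ lies in $\mathcal I$; and $\mathcal I$ is generated by paths of length two. Let $A^!=\Bbbk\mathcal Q^!/\mathcal I^!$ be its Koszul (quadratic) dual: $\mathcal Q^!$ has the same vertices and, for each arrow $\alpha$ of $\mathcal Q$, an arrow $\alpha^!$ from $\mathfrak t(\alpha)$ to $\mathfrak s(\alpha)$; and $\mathcal I^!$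 is generated by the $\alpha^!\beta^!$ with $\beta\alpha$ a path of length two in $\mathcal Q$ and $\beta\alpha\notin\mathcal I$. For a bound quiver $(\mathcal Q,\mathcal I)$, a path $a_1\cdots a_l$ is a forbidden thread (resp. permitted thread) if $a_ia_{i+1}\in\mathcal I$ (resp. $a_ia_{i+1}\notin\mathcal I$) for $1\le i\le l-1$ and the path is maximal with this property: $a_l\alpha\notin\mathcal I$ (resp. $a_l\alpha\in\mathcal I$) for every arrow $\alpha$ with $\mathfrak s(\alpha)=\mathfrak t(a_l)$, and $\alpha a_1\notin\mathcal I$ (resp. $\alpha a_1\in\mathcal I$) for every arrow $\alpha$ with $\mathfrak t(\alpha)=\mathfrak s(a_1)$. The path of length $0$ at $v$ is a (forbidden and permitted) thread exactly if no arrow starts or ends at $v$. Write $\mathrm{forb}(A)$, $\mathrm{perm}(A)$ for the sets of these threads. For a path $q=a_1\cdots a_l$ let $\mathsf v_q:\Bbbk\mathcal Q/\mathcal I\to\Bbbk$ be the linear map $\sum_\wp k_\wp\wp+\mathcal I\mapsto k_{\mathfrak s(a_1)}+\cdots+k_{\mathfrak s(a_l)}$, where $k_x$ is the coefficient of the length-zero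 path $e_x$; let $\widetilde l_q$ be the number of elements of $\{\mathfrak s(a_i)\mid 1\le i\le l\}$, and let $$\mathop{\int\cdots\int}_{[0,1]^{\times\widetilde l_q}}\mathsf v_q\,\mathrm d\mu$$ be the Lebesgue integral of $\mathsf v_q\bigl(\sum_x k_xe_x\bigr)$ over $(k_x)\in[0,1]^{\widetilde l_q}$, $x$ running over that set (the integral is $0$ if $l=0$). If $\mathrm{gl.dim}\,A<+\infty$, then $$\frac{\mathrm{gl.dim}\,A}{2}=\sup_{F\in\mathrm{forb}(A)}\ \mathop{\int\cdots\int}_{[0,1]^{\times\widetilde l_F}}\mathsf v_F\,\mathrm d\mu=\sup_{P\in\mathrm{perm}(A^!)}\ \mathop{\int\cdots\int}_{[0,1]^{\times\widetilde l_P}}\mathsf v_P\,\mathrm d\mu ,$$ where $\mathsf v_P$ is taken on $A^!$ and $\widetilde l_P$ in $\mathcal Q^!$. -/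

import Mathlib

open CategoryTheory MeasureTheory
open scoped ComplexOrder

universe u v w

namespace GentleAlg

/-- A quiver with vertex set `V` and arrow set `E`: every arrow has a starting point and an
ending point. -/
structure QuiverData (V : Type u) (E : Type v) where
  /-- the starting point of an arrow -/
  s : E → V
  /-- the ending point of an arrow -/
  t : E → V

namespace QuiverData

variable {V : Type u} {E : Type v} (Q : QuiverData V E)

/-- The opposite quiver: same vertices and arrows, starting and ending points exchanged. -/
def op : QuiverData V E where
  s := Q.t
  t := Q.s

/-- `Q.IsWalk x [a₁, …, a_l]`: the arrow `a₁` starts at `x` and each `a_{i+1}` starts at the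
ending point of `a_i` (no condition if `l = 0`). -/
def IsWalk : V → List E → Prop
  | _, [] => True
  | x, a :: as => Q.s a = x ∧ IsWalk (Q.t a) as

/-- The ending point of the walk `[a₁, …, a_l]` from `x`; it is `x` if `l = 0`. -/
def endpoint : V → List E → V
  | x, [] => x
  | _, a :: as => endpoint (Q.t a) as

theorem endpoint_append (x : V) (l m : List E) :
    Q.endpoint x (l ++ m) = Q.endpoint (Q.endpoint x l) m := by
  induction l generalizing x with
  | nil => rfl
  | cons a l ih => exact ih _

theorem isWalk_append (x : V) (l m : List E) :
    Q.IsWalk x (l ++ m) ↔ Q.IsWalk x l ∧ Q.IsWalk (Q.endpoint x l) m := by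
  induction l generalizing x with
  | nil => simp [IsWalk, endpoint]
  | cons a l ih => simp [IsWalk, endpoint, ih, and_assoc]

/-- A path `a₁ ⋯ a_l` (`l ≥ 0`) on the quiver, `t (a_i) = s (a_{i+1})`. The starting point is
recorded, so that there is one path of length zero at every vertex. -/
@[ext] structure Path where
  /-- the starting point of the path -/
  src : V
  /-- the arrows of the path, in order -/
  arrows : List E
  isWalk : Q.IsWalk src arrows

namespace Path

variable {Q}

/-- The ending point of a path. -/
def tgt (p : Q.Path) : V := Q.endpoint p.src p.arrows

/-- The length of a path. -/
def length (p : Q.Path) : ℕ := p.arrows.length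

variable (Q) in
/-- The path of length zero at a vertex. -/
def trivial (x : V) : Q.Path := ⟨x, [], True.intro⟩

variable (Q) in
/-- An arrow as a path of length one. -/
def ofArrow (a : E) : Q.Path := ⟨Q.s a, [a], rfl, True.intro⟩

/-- Concatenation of paths: first `p`, then `q`. -/
def comp (p q : Q.Path) (h : p.tgt = q.src) : Q.Path :=
  ⟨p.src, p.arrows ++ q.arrows, (Q.isWalk_append _ _ _).2 ⟨p.isWalk, by
    have := q.isWalk; rw [← h] at this; exact this⟩⟩

theorem tgt_comp (p q : Q.Path) (h : p.tgt = q.src) : (p.comp q h).tgt = q.tgt := by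
  have h' : Q.endpoint p.src p.arrows = q.src := h
  simp only [tgt, comp, endpoint_append, h']

end Path

end QuiverData

section PathMul

variable (𝕜 : Type w) [Field 𝕜] {V : Type u} {E : Type v} {Q : QuiverData V E}

open Classical in
/-- The product of two paths in the vector space with basis the set of all paths: the
concatenation `pq` if `p` ends where `q` starts, and zero otherwise. -/
noncomputable def mulPath (p q : Q.Path) : Q.Path →₀ 𝕜 :=
  if h : p.tgt = q.src then Finsupp.single (p.comp q h) 1 else 0

variable (Q) in
/-- The bilinear extension of `mulPath`. -/
noncomputable def mulHom : (Q.Path →₀ 𝕜) →ₗ[𝕜] (Q.Path →₀ 𝕜) →ₗ[𝕜] (Q.Path →₀ 𝕜) :=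
  Finsupp.lift _ 𝕜 Q.Path fun p => Finsupp.lift _ 𝕜 Q.Path fun q => mulPath 𝕜 p q

theorem mulHom_single_single (p q : Q.Path) (a b : 𝕜) :
    mulHom 𝕜 Q (Finsupp.single p a) (Finsupp.single q b) = (a * b) • mulPath 𝕜 p q := by
  simp [mulHom, Finsupp.sum_single_index, mul_smul]

theorem mulHom_mulPath_left (p q r : Q.Path) :
    mulHom 𝕜 Q (mulPath 𝕜 p q) (Finsupp.single r 1) =
      mulHom 𝕜 Q (Finsupp.single p 1) (mulPath 𝕜 q r) := by
  by_cases h : p.tgt = q.src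
  · by_cases h' : q.tgt = r.src
    · have h1 : (p.comp q h).tgt = r.src := by rw [QuiverData.Path.tgt_comp, h']
      have h2 : p.tgt = (q.comp r h').src := h
      simp only [mulPath, dif_pos h, dif_pos h', mulHom_single_single, dif_pos h1, dif_pos h2]
      congr 2
      simp [QuiverData.Path.comp]
    · have h1 : ¬ (p.comp q h).tgt = r.src := by rwa [QuiverData.Path.tgt_comp]
      simp [mulPath, h, h', mulHom_single_single, h1]
  · by_cases h' : q.tgt = r.src
    · have h2 : ¬ p.tgt = (q.comp r h').src := h
      simp [mulPath, h, h', mulHom_single_single, h2]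
    · simp [mulPath, h, h']

theorem mulHom_assoc (x y z : Q.Path →₀ 𝕜) :
    mulHom 𝕜 Q (mulHom 𝕜 Q x y) z = mulHom 𝕜 Q x (mulHom 𝕜 Q y z) := by
  induction x using Finsupp.induction_linear with
  | zero => simp
  | add f g hf hg => simp [hf, hg]
  | single p a =>
    induction y using Finsupp.induction_linear with
    | zero => simp
    | add f g hf hg => simp [hf, hg]
    | single q b =>
      induction z using Finsupp.induction_linear with
      | zero => simp
      | add f g hf hg => simp only [map_add, hf, hg]
      | single r c =>
        have hr : Finsupp.single r c = c • (Finsupp.single r 1 : Q.Path →₀ 𝕜) := by simp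
        have hp : Finsupp.single p a = a • (Finsupp.single p 1 : Q.Path →₀ 𝕜) := by simp
        rw [mulHom_single_single, mulHom_single_single, hr, hp]
        simp only [map_smul, LinearMap.smul_apply, mulHom_mulPath_left, smul_smul]
        congr 1
        ring

/-- The sum of all paths of length zero. -/
noncomputable def sumTrivial (Q : QuiverData V E) [Fintype V] : Q.Path →₀ 𝕜 :=
  ∑ x : V, Finsupp.single (QuiverData.Path.trivial Q x) 1

theorem sumTrivial_mul [Fintype V] (x : Q.Path →₀ 𝕜) : mulHom 𝕜 Q (sumTrivial 𝕜 Q) x = x := by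
  induction x using Finsupp.induction_linear with
  | zero => simp
  | add f g hf hg => simp [hf, hg]
  | single p a =>
    rw [sumTrivial, map_sum, LinearMap.sum_apply, Finset.sum_eq_single p.src]
    · have h : (QuiverData.Path.trivial Q p.src).tgt = p.src := rfl
      rw [mulHom_single_single, mulPath, dif_pos h]
      simp [QuiverData.Path.comp, QuiverData.Path.trivial]
    · intro b _ hb
      have h : ¬ (QuiverData.Path.trivial Q b).tgt = p.src := hb
      rw [mulHom_single_single, mulPath, dif_neg h, smul_zero]
    · simp

theorem mul_sumTrivial [Fintype V] (x : Q.Path →₀ 𝕜) : mulHom 𝕜 Q x (sumTrivial 𝕜 Q) = x := by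
  induction x using Finsupp.induction_linear with
  | zero => simp
  | add f g hf hg => simp [hf, hg]
  | single p a =>
    rw [sumTrivial, map_sum, Finset.sum_eq_single p.tgt]
    · have h : p.tgt = (QuiverData.Path.trivial Q p.tgt).src := rfl
      rw [mulHom_single_single, mulPath, dif_pos h]
      simp [QuiverData.Path.comp, QuiverData.Path.trivial]
    · intro b _ hb
      have h : ¬ p.tgt = (QuiverData.Path.trivial Q b).src := fun h => hb h.symm
      rw [mulHom_single_single, mulPath, dif_neg h, smul_zero]
    · simp

end PathMul

/-- The path algebra `𝕜Q`: the `𝕜`-vector space with basis the set of all paths on `Q`, with the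
multiplication that extends concatenation of paths bilinearly. -/
def PathAlgebra (𝕜 : Type w) [Field 𝕜] {V : Type u} {E : Type v} (Q : QuiverData V E) :
    Type (max u v w) :=
  Q.Path →₀ 𝕜

namespace PathAlgebra

variable {𝕜 : Type w} [Field 𝕜] {V : Type u} {E : Type v} {Q : QuiverData V E}

noncomputable instance : AddCommGroup (PathAlgebra 𝕜 Q) :=
  inferInstanceAs (AddCommGroup (Q.Path →₀ 𝕜))

noncomputable instance : Module 𝕜 (PathAlgebra 𝕜 Q) :=
  inferInstanceAs (Module 𝕜 (Q.Path →₀ 𝕜))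

variable (𝕜 Q) in
/-- An element of the path algebra as a finitely supported family of coefficients. -/
noncomputable def toFinsupp : PathAlgebra 𝕜 Q ≃ₗ[𝕜] (Q.Path →₀ 𝕜) := LinearEquiv.refl 𝕜 _

/-- The basis element given by the path `p`. -/
noncomputable def ofPath (p : Q.Path) : PathAlgebra 𝕜 Q :=
  (toFinsupp 𝕜 Q).symm (Finsupp.single p 1)

/-- The basis element given by an arrow. -/
noncomputable def arrow (a : E) : PathAlgebra 𝕜 Q := ofPath (QuiverData.Path.ofArrow Q a)

noncomputable instance [Fintype V] : Ring (PathAlgebra 𝕜 Q) where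
  __ := (inferInstance : AddCommGroup (PathAlgebra 𝕜 Q))
  mul x y := (toFinsupp 𝕜 Q).symm (mulHom 𝕜 Q (toFinsupp 𝕜 Q x) (toFinsupp 𝕜 Q y))
  one := (toFinsupp 𝕜 Q).symm (sumTrivial 𝕜 Q)
  mul_assoc x y z := mulHom_assoc 𝕜 (Q := Q) x y z
  one_mul x := sumTrivial_mul 𝕜 (Q := Q) x
  mul_one x := mul_sumTrivial 𝕜 (Q := Q) x
  left_distrib x y z := (mulHom 𝕜 Q x).map_add y z
  right_distrib x y z := (mulHom 𝕜 Q).map_add₂ x y z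
  zero_mul x := (mulHom 𝕜 Q).map_zero₂ x
  mul_zero x := (mulHom 𝕜 Q x).map_zero

theorem mulHom_apply_trivial (x y : Q.Path →₀ 𝕜) (e : V) :
    mulHom 𝕜 Q x y (QuiverData.Path.trivial Q e) =
      x (QuiverData.Path.trivial Q e) * y (QuiverData.Path.trivial Q e) := by
  classical
  induction x using Finsupp.induction_linear with
  | zero => simp
  | add f g hf hg => simp [hf, hg, add_mul]
  | single p a =>
    induction y using Finsupp.induction_linear with
    | zero => simp
    | add f g hf hg => simp only [map_add, Finsupp.add_apply, hf, hg, mul_add]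
    | single q b =>
      rw [mulHom_single_single, mulPath]
      rcases p with ⟨x, l, hl⟩
      rcases q with ⟨y, m, hm⟩
      cases l with
      | nil =>
        cases m with
        | nil =>
          by_cases hxy : x = y
          · subst hxy
            by_cases hx : x = e <;>
              simp [QuiverData.Path.tgt, QuiverData.endpoint, QuiverData.Path.comp,
                QuiverData.Path.trivial, QuiverData.Path.ext_iff, hx]
          · by_cases hx : x = e
            · subst hx
              simp [QuiverData.Path.tgt, QuiverData.endpoint,
                QuiverData.Path.trivial, QuiverData.Path.ext_iff, hxy]
            · simp [QuiverData.Path.tgt, QuiverData.endpoint,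
                QuiverData.Path.trivial, Finsupp.single_apply, QuiverData.Path.ext_iff, hxy, hx]
        | cons c m =>
          split_ifs <;>
            simp [QuiverData.Path.comp, QuiverData.Path.trivial, Finsupp.single_apply, QuiverData.Path.ext_iff]
      | cons c l =>
        split_ifs <;>
          simp [QuiverData.Path.comp, QuiverData.Path.trivial, Finsupp.single_apply, QuiverData.Path.ext_iff]

variable [Fintype V]

theorem toFinsupp_mul (x y : PathAlgebra 𝕜 Q) :
    toFinsupp 𝕜 Q (x * y) = mulHom 𝕜 Q (toFinsupp 𝕜 Q x) (toFinsupp 𝕜 Q y) := rfl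

theorem toFinsupp_one : toFinsupp 𝕜 Q 1 = sumTrivial 𝕜 Q := rfl

noncomputable instance : Algebra 𝕜 (PathAlgebra 𝕜 Q) :=
  Algebra.ofModule
    (fun r x y => (toFinsupp 𝕜 Q).injective (by simp [toFinsupp_mul]))
    (fun r x y => (toFinsupp 𝕜 Q).injective (by simp [toFinsupp_mul]))

theorem sumTrivial_apply_trivial (e : V) :
    sumTrivial 𝕜 Q (QuiverData.Path.trivial Q e) = 1 := by
  classical
  rw [sumTrivial, Finsupp.finsetSum_apply, Finset.sum_eq_single e]
  · simp
  · intro b _ hb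
    simp [QuiverData.Path.trivial, QuiverData.Path.ext_iff, hb]
  · simp

variable (𝕜 Q) in
/-- The coefficient of the path of length zero at `e`, as a map on the path algebra; it is
multiplicative. -/
noncomputable def trivialCoeff (e : V) : PathAlgebra 𝕜 Q →ₐ[𝕜] 𝕜 :=
  AlgHom.ofLinearMap
    ((Finsupp.lapply (QuiverData.Path.trivial Q e)).comp (toFinsupp 𝕜 Q).toLinearMap)
    (sumTrivial_apply_trivial e)
    (fun x y => mulHom_apply_trivial (toFinsupp 𝕜 Q x) (toFinsupp 𝕜 Q y) e)

theorem trivialCoeff_apply (e : V) (x : PathAlgebra 𝕜 Q) :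
    trivialCoeff 𝕜 Q e x = toFinsupp 𝕜 Q x (QuiverData.Path.trivial Q e) := rfl

end PathAlgebra

/-- A bound quiver `(Q, I)`: a quiver `Q` together with a two-sided ideal `I` of `𝕜Q` that is
generated by linear combinations of paths of length at least two. -/
structure BoundQuiver (𝕜 : Type w) [Field 𝕜] (V : Type u) [Fintype V] (E : Type v) where
  /-- the quiver `Q` -/
  quiver : QuiverData V E
  /-- the ideal `I` -/
  ideal : TwoSidedIdeal (PathAlgebra 𝕜 quiver)
  exists_generators : ∃ S : Set (PathAlgebra 𝕜 quiver),
    (∀ x ∈ S, ∀ p ∈ (PathAlgebra.toFinsupp 𝕜 quiver x).support, 2 ≤ p.length) ∧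
      ideal = TwoSidedIdeal.span S

namespace BoundQuiver

variable {𝕜 : Type w} [Field 𝕜] {V : Type u} [Fintype V] {E : Type v} (B : BoundQuiver 𝕜 V E)

/-- The path `ab` (for `t a = s b`) as an element of the path algebra of the quiver. -/
noncomputable def arrowMul (a b : E) : PathAlgebra 𝕜 B.quiver :=
  PathAlgebra.arrow a * PathAlgebra.arrow b

/-- The algebra `𝕜Q/I` of a bound quiver. -/
abbrev Alg : Type (max u v w) := PathAlgebra 𝕜 B.quiver ⧸ B.ideal.asIdeal

/-- The idempotent `e_x` of `𝕜Q/I`, the class of the path of length zero at the vertex `x`. -/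
noncomputable def idem (x : V) : B.Alg :=
  Ideal.Quotient.mk B.ideal.asIdeal (PathAlgebra.ofPath (QuiverData.Path.trivial B.quiver x))

theorem trivialCoeff_eq_zero (e : V) (x : PathAlgebra 𝕜 B.quiver)
    (hx : x ∈ B.ideal.asIdeal) : PathAlgebra.trivialCoeff 𝕜 B.quiver e x = 0 := by
  obtain ⟨S, hS, hI⟩ := B.exists_generators
  rw [TwoSidedIdeal.mem_asIdeal, hI] at hx
  have hle : TwoSidedIdeal.span S ≤ TwoSidedIdeal.ker (PathAlgebra.trivialCoeff 𝕜 B.quiver e) := by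
    rw [TwoSidedIdeal.span_le]
    intro y hy
    rw [SetLike.mem_coe, TwoSidedIdeal.mem_ker, PathAlgebra.trivialCoeff_apply]
    by_contra hne
    have := hS y hy _ (Finsupp.mem_support_iff.2 hne)
    simp [QuiverData.Path.length, QuiverData.Path.trivial] at this
  exact (TwoSidedIdeal.mem_ker _).1 (hle hx)

/-- The coefficient `k_{e_x}` of the path of length zero at the vertex `x`, on `𝕜Q/I`. It is well
defined because `I` is generated by combinations of paths of length at least two. -/
noncomputable def vertexCoeff (x : V) : B.Alg →ₐ[𝕜] 𝕜 :=
  Ideal.Quotient.liftₐ B.ideal.asIdeal (PathAlgebra.trivialCoeff 𝕜 B.quiver x)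
    (B.trivialCoeff_eq_zero x)

/-- The vertex homomorphism `v_q` of a path `q = a₁ ⋯ a_l`: it sends an element of `𝕜Q/I` with
coefficients `k_℘` to `k_{s(a₁)} + ⋯ + k_{s(a_l)}`, where `k_x` is the coefficient of `e_x`. -/
noncomputable def vertexHom (q : B.quiver.Path) : B.Alg →ₗ[𝕜] 𝕜 :=
  (q.arrows.map fun a => (B.vertexCoeff (B.quiver.s a)).toLinearMap).sum

/-- A permitted thread: a path `a₁ ⋯ a_l` with `a_i a_{i+1} ∉ I` that is maximal, that is, for
every arrow `α` with `s α = t a_l` one has `a_l α ∈ I`, and for every arrow `α` with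
`t α = s a₁` one has `α a₁ ∈ I`. The path of length zero at `x` is a permitted thread iff no arrow
starts or ends at `x`. -/
structure IsPermittedThread (p : B.quiver.Path) : Prop where
  chain : p.arrows.IsChain fun a b => B.arrowMul a b ∉ B.ideal
  maximal_right : ∀ α : E, B.quiver.s α = p.tgt →
    ∃ a ∈ p.arrows.getLast?, B.arrowMul a α ∈ B.ideal
  maximal_left : ∀ α : E, B.quiver.t α = p.src →
    ∃ a ∈ p.arrows.head?, B.arrowMul α a ∈ B.ideal

/-- A forbidden thread: a path `a₁ ⋯ a_l` with `a_i a_{i+1} ∈ I` that is maximal, that is, for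
every arrow `α` with `s α = t a_l` one has `a_l α ∉ I`, and for every arrow `α` with
`t α = s a₁` one has `α a₁ ∉ I`. The path of length zero at `x` is a forbidden thread iff no arrow
starts or ends at `x`. -/
structure IsForbiddenThread (p : B.quiver.Path) : Prop where
  chain : p.arrows.IsChain fun a b => B.arrowMul a b ∈ B.ideal
  maximal_right : ∀ α : E, B.quiver.s α = p.tgt →
    ∃ a ∈ p.arrows.getLast?, B.arrowMul a α ∉ B.ideal
  maximal_left : ∀ α : E, B.quiver.t α = p.src →
    ∃ a ∈ p.arrows.head?, B.arrowMul α a ∉ B.ideal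

/-- `𝕜Q/I` is a gentle algebra: it is finite-dimensional and `(Q, I)` is a gentle pair. -/
structure IsGentle : Prop where
  finiteDimensional : FiniteDimensional 𝕜 B.Alg
  starting_le_two : ∀ x : V, {a : E | B.quiver.s a = x}.encard ≤ 2
  ending_le_two : ∀ x : V, {a : E | B.quiver.t a = x}.encard ≤ 2
  /-- if two different arrows end where `b` starts, exactly one of the two products is in `I` -/
  left_xor : ∀ a₁ a₂ b : E, a₁ ≠ a₂ → B.quiver.t a₁ = B.quiver.s b →
    B.quiver.t a₂ = B.quiver.s b → Xor (B.arrowMul a₁ b ∈ B.ideal) (B.arrowMul a₂ b ∈ B.ideal)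
  /-- if two different arrows start where `a` ends, exactly one of the two products is in `I` -/
  right_xor : ∀ a b₁ b₂ : E, b₁ ≠ b₂ → B.quiver.t a = B.quiver.s b₁ →
    B.quiver.t a = B.quiver.s b₂ → Xor (B.arrowMul a b₁ ∈ B.ideal) (B.arrowMul a b₂ ∈ B.ideal)
  /-- `I` is generated by paths of length two -/
  quadratic : ∃ R : Set (E × E), (∀ r ∈ R, B.quiver.t r.1 = B.quiver.s r.2) ∧
    B.ideal = TwoSidedIdeal.span ((fun r => B.arrowMul r.1 r.2) '' R)

/-- The generators `α^! β^!` of the ideal of the Koszul dual: `βα` is a path of length two in `Q`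
(equivalently `α^! β^!` is one in the opposite quiver) that does not lie in `I`. -/
def dualGenerators : Set (PathAlgebra 𝕜 B.quiver.op) :=
  {x | ∃ α β : E, B.quiver.t β = B.quiver.s α ∧ B.arrowMul β α ∉ B.ideal ∧
    x = PathAlgebra.arrow α * PathAlgebra.arrow β}

theorem length_of_mem_support_arrow_mul_arrow {Q : QuiverData V E} (a b : E) (p : Q.Path)
    (hp : p ∈ (PathAlgebra.toFinsupp 𝕜 Q
      (PathAlgebra.arrow a * PathAlgebra.arrow b)).support) : 2 ≤ p.length := by
  classical
  have h : PathAlgebra.toFinsupp 𝕜 Q (PathAlgebra.arrow a * PathAlgebra.arrow b) =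
      mulPath 𝕜 (QuiverData.Path.ofArrow Q a) (QuiverData.Path.ofArrow Q b) := by
    rw [PathAlgebra.toFinsupp_mul]
    simp [PathAlgebra.arrow, PathAlgebra.ofPath, mulHom_single_single]
  rw [h, mulPath] at hp
  split_ifs at hp
  · have := Finsupp.support_single_subset hp
    rw [Finset.mem_singleton] at this
    subst this
    simp [QuiverData.Path.length, QuiverData.Path.comp, QuiverData.Path.ofArrow]
  · simp at hp

/-- The bound quiver `(Q^!, I^!)` of the Koszul (quadratic) dual `A^! = 𝕜Q^!/I^!` of a gentle
algebra `A = 𝕜Q/I`: `Q^!` is the opposite quiver, and `I^!` is generated by the paths `α^! β^!` of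
length two such that `βα ∉ I`. -/
noncomputable def koszulDual : BoundQuiver 𝕜 V E where
  quiver := B.quiver.op
  ideal := TwoSidedIdeal.span B.dualGenerators
  exists_generators := by
    refine ⟨B.dualGenerators, ?_, rfl⟩
    rintro x ⟨α, β, -, -, rfl⟩ p hp
    exact length_of_mem_support_arrow_mul_arrow α β p hp

open Classical in
/-- The set `{s(a₁), …, s(a_l)}` of starting points of the arrows of a path `a₁ ⋯ a_l`. -/
noncomputable def sources (q : B.quiver.Path) : Finset V :=
  (q.arrows.map B.quiver.s).toFinset

end BoundQuiver

/-- The multiple integral of `v_q` over `[0,1]^l`, `l` the number of different starting points of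
the arrows of `q`, with respect to Lebesgue measure. The variables are the coefficients of the
idempotents `e_x` at these starting points. -/
noncomputable def BoundQuiver.vertexIntegral {𝕜 : Type w} [RCLike 𝕜] {V : Type u} [Fintype V]
    {E : Type v} (B : BoundQuiver 𝕜 V E) (q : B.quiver.Path) : 𝕜 :=
  ∫ k in Set.Icc (0 : B.sources q → ℝ) 1,
    B.vertexHom q (∑ x : B.sources q, ((k x : ℝ) : 𝕜) • B.idem x)

/-- The (left) global dimension of a ring, the supremum of the projective dimensions of its left
modules. -/
noncomputable def globalDimension (R : Type u) [Ring R] : WithBot ℕ∞ :=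
  ⨆ M : ModuleCat.{u} R, projectiveDimension M

end GentleAlg

/-!
The algebra `A = 𝕜Q/I` of a gentle pair is monomial: the paths without a relation form a basis, and
an element of `𝕜Q` lies in `I` exactly if each of its paths contains a relation
(`IsGentle.mem_ideal_iff`). Say that `B.Rel a b` holds if `ab` is a path of length two in `I`; a
forbidden path is a chain for `B.Rel`, so everything reduces to showing that the global dimension
of `A`, if finite, is the greatest length of such a chain.

For an arrow `a`, right multiplication by `a` maps the projective left ideal `A e_{s(a)}` onto
`A a`. Comparing coefficients of paths, its kernel is `A a'` if there is an arrow `a'` with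
`B.Rel a' a`, necessarily unique by gentleness, and zero otherwise (`IsGentle.exact_mulArr`,
`IsGentle.mulArr_injective`). Hence the projective resolution of `A a` runs backwards through the
chain of relations ending with `a`.

* Upper bound (`IsGentle.pdLT_of_forall_chain`). The radical of `A e_x` is the direct sum of the
  `A a` with `t(a) = x`, which bounds the projective dimension of the simple module at `x`, and of
  all direct sums of copies of it. The ideal generated by the arrows is nilpotent since `A` is
  finite-dimensional, so every module, finitely generated or not, has a finite filtration whose
  layers are such direct sums.
* Lower bound (`IsGentle.length_le_of_forall_pdLT`). The inclusions `A a ⊆ A e_{t(a)}` never split,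
  because `a ∉ aAa` (`IsGentle.not_projective_of_exact`). So the resolution of
  `A e_{t(a)} / A a` does not stop before the chain of relations is used up.

A chain of greatest length is maximal, so it is a forbidden thread; read backwards it is a permitted
thread of the quadratic dual, because `α^!β^! ∉ I^!` holds exactly if `βα ∈ I`. Finally, the
integral of the vertex homomorphism of a path over the cube is half the length of the path, each
arrow contributing the mean value `1/2` of one coordinate (`vertexIntegral_eq`).
-/

/-! ### Paths and products in the path algebra -/

namespace GentleAlg

namespace QuiverData.Path

variable {V : Type u} {E : Type v} {Q : QuiverData V E}

/-- A path splits along any splitting of its list of arrows. -/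
theorem exists_eq_comp (p : Q.Path) {l m : List E} (h : p.arrows = l ++ m) :
    ∃ (q r : Q.Path) (hqr : q.tgt = r.src), p = q.comp r hqr ∧ q.arrows = l ∧ r.arrows = m := by
  have hw := p.isWalk
  rw [h, Q.isWalk_append] at hw
  exact ⟨⟨p.src, l, hw.1⟩, ⟨_, m, hw.2⟩, rfl, Path.ext rfl h, rfl, rfl⟩

theorem eq_ofArrow (p : Q.Path) {a : E} (h : p.arrows = [a]) : p = ofArrow Q a := by
  have hw := p.isWalk
  rw [h] at hw
  exact Path.ext hw.1.symm h

theorem eq_trivial (p : Q.Path) (h : p.arrows = []) : p = trivial Q p.src := Path.ext rfl h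

@[simp] theorem tgt_trivial (x : V) : (trivial Q x).tgt = x := rfl
@[simp] theorem tgt_ofArrow (a : E) : (ofArrow Q a).tgt = Q.t a := rfl
@[simp] theorem arrows_comp (p q : Q.Path) (h) : (p.comp q h).arrows = p.arrows ++ q.arrows := rfl

/-- A path of positive length is a path followed by its last arrow. -/
theorem exists_eq_comp_ofArrow (p : Q.Path) {a : E} (h : p.arrows.getLast? = some a) :
    ∃ (q : Q.Path) (hq : q.tgt = (ofArrow Q a).src), p = q.comp (ofArrow Q a) hq := by
  obtain ⟨l, hl⟩ := List.getLast?_eq_some_iff.1 h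
  obtain ⟨q, r, hqr, hp, -, hr⟩ := p.exists_eq_comp hl
  obtain rfl := r.eq_ofArrow hr
  exact ⟨q, hqr, hp⟩

theorem tgt_eq_of_getLast? (p : Q.Path) {a : E} (h : p.arrows.getLast? = some a) :
    p.tgt = Q.t a := by
  obtain ⟨q, hq, rfl⟩ := p.exists_eq_comp_ofArrow h
  rw [tgt_comp, tgt_ofArrow]

theorem src_eq_of_head? (p : Q.Path) {a : E} (h : p.arrows.head? = some a) : p.src = Q.s a := by
  obtain ⟨x, l, hw⟩ := p
  cases l with
  | nil => simp at h
  | cons b l =>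
    simp only [List.head?_cons, Option.some.injEq] at h
    subst h
    exact hw.1.symm

end QuiverData.Path

open QuiverData (Path)

namespace PathAlgebra

variable {𝕜 : Type w} [Field 𝕜] {V : Type u} {E : Type v} {Q : QuiverData V E}

theorem toFinsupp_ofPath (p : Q.Path) :
    toFinsupp 𝕜 Q (ofPath p) = Finsupp.single p 1 := rfl

variable [Fintype V]

theorem ofPath_mul_ofPath (p q : Q.Path) (h : p.tgt = q.src) :
    (ofPath p * ofPath q : PathAlgebra 𝕜 Q) = ofPath (p.comp q h) := by
  apply (toFinsupp 𝕜 Q).injective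
  rw [toFinsupp_mul, toFinsupp_ofPath, toFinsupp_ofPath, toFinsupp_ofPath, mulHom_single_single,
    mulPath, dif_pos h, one_mul, one_smul]

theorem ofPath_mul_ofPath_of_ne (p q : Q.Path) (h : p.tgt ≠ q.src) :
    (ofPath p * ofPath q : PathAlgebra 𝕜 Q) = 0 := by
  apply (toFinsupp 𝕜 Q).injective
  rw [toFinsupp_mul, toFinsupp_ofPath, toFinsupp_ofPath, mulHom_single_single,
    mulPath, dif_neg h, smul_zero, map_zero]

theorem eq_sum_ofPath (x : PathAlgebra 𝕜 Q) :
    x = ∑ p ∈ (toFinsupp 𝕜 Q x).support, toFinsupp 𝕜 Q x p • ofPath p := by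
  apply (toFinsupp 𝕜 Q).injective
  rw [map_sum]
  simp only [map_smul, toFinsupp_ofPath, Finsupp.smul_single, smul_eq_mul, mul_one]
  exact (Finsupp.sum_single (toFinsupp 𝕜 Q x)).symm

theorem toFinsupp_mul_eq_sum (x y : PathAlgebra 𝕜 Q) :
    toFinsupp 𝕜 Q (x * y) = ∑ p ∈ (toFinsupp 𝕜 Q x).support, ∑ q ∈ (toFinsupp 𝕜 Q y).support,
      (toFinsupp 𝕜 Q x p * toFinsupp 𝕜 Q y q) • mulPath 𝕜 p q := by
  conv_lhs => rw [eq_sum_ofPath x, eq_sum_ofPath y, Finset.sum_mul_sum]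
  simp only [map_sum]
  refine Finset.sum_congr rfl fun p _ => Finset.sum_congr rfl fun q _ => ?_
  rw [toFinsupp_mul, map_smul, map_smul, map_smul, LinearMap.smul_apply, map_smul,
    toFinsupp_ofPath, toFinsupp_ofPath, mulHom_single_single, smul_smul, one_mul, one_smul]

/-- The paths that occur in a product are concatenations of paths that occur in the factors. -/
theorem exists_of_mem_support_mul {x y : PathAlgebra 𝕜 Q} {r : Q.Path}
    (hr : r ∈ (toFinsupp 𝕜 Q (x * y)).support) :
    ∃ p ∈ (toFinsupp 𝕜 Q x).support, ∃ q ∈ (toFinsupp 𝕜 Q y).support, ∃ h : p.tgt = q.src,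
      r = p.comp q h := by
  classical
  rw [toFinsupp_mul_eq_sum] at hr
  obtain ⟨p, hp, hr⟩ := Finset.mem_biUnion.1 (Finsupp.support_finsetSum hr)
  obtain ⟨q, hq, hr⟩ := Finset.mem_biUnion.1 (Finsupp.support_finsetSum hr)
  have hr := Finsupp.support_smul hr
  refine ⟨p, hp, q, hq, ?_⟩
  rw [mulPath] at hr
  split_ifs at hr with h
  · exact ⟨h, Finset.mem_singleton.1 (Finsupp.support_single_subset hr)⟩
  · simp at hr

/-- Right multiplication by an arrow moves the coefficient of a path `p` to the path `pa`. -/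
theorem toFinsupp_mul_arrow_comp (x : PathAlgebra 𝕜 Q) (a : E) (p : Q.Path)
    (h : p.tgt = (Path.ofArrow Q a).src) :
    toFinsupp 𝕜 Q (x * arrow a) (p.comp (Path.ofArrow Q a) h) = toFinsupp 𝕜 Q x p := by
  classical
  have key : ∀ f : Q.Path →₀ 𝕜, mulHom 𝕜 Q f (Finsupp.single (Path.ofArrow Q a) 1)
      (p.comp (Path.ofArrow Q a) h) = f p := by
    intro f
    induction f using Finsupp.induction_linear with
    | zero => simp
    | add f g hf hg => simp [hf, hg]
    | single q c =>
      rw [mulHom_single_single, mulPath]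
      have hinj : ∀ hq, (q.comp (Path.ofArrow Q a) hq = p.comp (Path.ofArrow Q a) h) ↔ q = p := by
        intro hq
        refine ⟨fun e => ?_, fun e => by subst e; rfl⟩
        have h1 := congrArg Path.src e
        have h2 := congrArg Path.arrows e
        exact QuiverData.Path.ext h1 (List.append_cancel_right h2)
      split_ifs with hq
      · simp [Finsupp.single_apply, hinj]
      · have : q ≠ p := fun e => hq (e ▸ h)
        simp [this]
  exact key _

theorem tgt_of_mem_support_mul_trivial {x : PathAlgebra 𝕜 Q} {e : V} {p : Q.Path}
    (hp : p ∈ (toFinsupp 𝕜 Q (x * ofPath (Path.trivial Q e))).support) : p.tgt = e := by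
  obtain ⟨q, -, r, hr, h, rfl⟩ := exists_of_mem_support_mul hp
  obtain rfl : r = Path.trivial Q e := Finset.mem_singleton.1 (Finsupp.support_single_subset hr)
  rw [Path.tgt_comp, Path.tgt_trivial]

theorem trivial_mul_arrow (a : E) :
    (ofPath (Path.trivial Q (Q.s a)) * arrow a : PathAlgebra 𝕜 Q) = arrow a :=
  ofPath_mul_ofPath (Path.trivial Q (Q.s a)) (Path.ofArrow Q a) rfl

theorem arrow_mul_trivial (a : E) :
    (arrow a * ofPath (Path.trivial Q (Q.t a)) : PathAlgebra 𝕜 Q) = arrow a :=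
  ofPath_mul_ofPath (Path.ofArrow Q a) (Path.trivial Q (Q.t a)) rfl

theorem trivial_mul_trivial (e : V) :
    (ofPath (Path.trivial Q e) * ofPath (Path.trivial Q e) : PathAlgebra 𝕜 Q) =
      ofPath (Path.trivial Q e) :=
  ofPath_mul_ofPath (Path.trivial Q e) (Path.trivial Q e) rfl

theorem smul_mem_twoSidedIdeal (I : TwoSidedIdeal (PathAlgebra 𝕜 Q)) (c : 𝕜)
    {x : PathAlgebra 𝕜 Q} (hx : x ∈ I) : c • x ∈ I := by
  rw [Algebra.smul_def]
  exact I.mul_mem_left _ _ hx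

/-! ### Ideals generated by paths of length two -/

/-- An ideal generated by paths of length two is monomial: it consists of the combinations of
those paths that contain one of the generators. -/
theorem mem_span_arrow_mul_arrow_iff {R : Set (E × E)} (hR : ∀ r ∈ R, Q.t r.1 = Q.s r.2)
    (x : PathAlgebra 𝕜 Q) :
    x ∈ TwoSidedIdeal.span ((fun r : E × E => (arrow r.1 * arrow r.2 : PathAlgebra 𝕜 Q)) '' R) ↔
      ∀ p ∈ (toFinsupp 𝕜 Q x).support, ¬ p.arrows.IsChain fun a b => (a, b) ∉ R := by
  classical
  constructor
  · intro hx
    let I : TwoSidedIdeal (PathAlgebra 𝕜 Q) := TwoSidedIdeal.mk'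
      {x | ∀ p ∈ (toFinsupp 𝕜 Q x).support, ¬ p.arrows.IsChain fun a b => (a, b) ∉ R}
      (by simp)
      (by
        intro x y hx hy p hp
        rw [map_add] at hp
        exact (Finset.mem_union.1 (Finsupp.support_add hp)).elim (hx p) (hy p))
      (by
        intro x hx p hp
        rw [map_neg, Finsupp.support_neg] at hp
        exact hx p hp)
      (by
        intro x y hy p hp hc
        obtain ⟨q, -, r, hr, h, rfl⟩ := exists_of_mem_support_mul hp
        exact hy r hr hc.right_of_append)
      (by
        intro x y hx p hp hc
        obtain ⟨q, hq, r, -, h, rfl⟩ := exists_of_mem_support_mul hp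
        exact hx q hq hc.left_of_append)
    have hle : TwoSidedIdeal.span
        ((fun r : E × E => (arrow r.1 * arrow r.2 : PathAlgebra 𝕜 Q)) '' R) ≤ I := by
      rw [TwoSidedIdeal.span_le]
      rintro _ ⟨⟨a, b⟩, hab, rfl⟩
      rw [SetLike.mem_coe, TwoSidedIdeal.mem_mk']
      intro p hp hc
      have hmul : (arrow a * arrow b : PathAlgebra 𝕜 Q) = ofPath ((Path.ofArrow Q a).comp
        (Path.ofArrow Q b) (hR _ hab)) := ofPath_mul_ofPath _ _ _
      simp only [hmul] at hp
      obtain rfl := Finset.mem_singleton.1 (Finsupp.support_single_subset hp)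
      simp only [Path.ofArrow, Path.arrows_comp, List.singleton_append, List.isChain_pair] at hc
      exact hc hab
    have := hle hx
    rwa [TwoSidedIdeal.mem_mk'] at this
  · intro hx
    rw [eq_sum_ofPath x]
    refine sum_mem fun p hp => smul_mem_twoSidedIdeal _ _ ?_
    have hc := hx p hp
    -- a path that is not a chain has the form `q₁ a b r₂` with `(a, b) ∈ R`
    rw [List.isChain_iff_forall_rel_of_append_cons_cons] at hc
    push Not at hc
    obtain ⟨a, b, l, m, hl, hab⟩ := hc
    rw [show l ++ a :: b :: m = (l ++ [a]) ++ ([b] ++ m) by simp] at hl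
    obtain ⟨q, r, hqr, rfl, hq, hr⟩ := p.exists_eq_comp hl
    obtain ⟨q₁, q₂, hq12, rfl, -, hq₂⟩ := q.exists_eq_comp hq
    obtain ⟨r₁, r₂, hr12, rfl, hr₁, -⟩ := r.exists_eq_comp hr
    obtain rfl := q₂.eq_ofArrow hq₂
    obtain rfl := r₁.eq_ofArrow hr₁
    rw [← ofPath_mul_ofPath, ← ofPath_mul_ofPath, ← ofPath_mul_ofPath, ← mul_assoc,
      mul_assoc (ofPath q₁)]
    exact TwoSidedIdeal.mul_mem_right _ _ _ (TwoSidedIdeal.mul_mem_left _ _ _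
      (TwoSidedIdeal.subset_span ⟨(a, b), hab, rfl⟩))

theorem ofPath_mem_span_arrow_mul_arrow_iff {R : Set (E × E)} (hR : ∀ r ∈ R, Q.t r.1 = Q.s r.2)
    (p : Q.Path) :
    (ofPath p : PathAlgebra 𝕜 Q) ∈
      TwoSidedIdeal.span ((fun r : E × E => (arrow r.1 * arrow r.2 : PathAlgebra 𝕜 Q)) '' R) ↔
      ¬ p.arrows.IsChain fun a b => (a, b) ∉ R := by
  rw [mem_span_arrow_mul_arrow_iff hR, toFinsupp_ofPath, Finsupp.support_single _ one_ne_zero]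
  simp

theorem arrow_mul_arrow_mem_span_iff {R : Set (E × E)} (hR : ∀ r ∈ R, Q.t r.1 = Q.s r.2)
    {a b : E} (h : Q.t a = Q.s b) :
    (arrow a * arrow b : PathAlgebra 𝕜 Q) ∈
      TwoSidedIdeal.span ((fun r : E × E => (arrow r.1 * arrow r.2 : PathAlgebra 𝕜 Q)) '' R) ↔
      (a, b) ∈ R := by
  have hmul : (arrow a * arrow b : PathAlgebra 𝕜 Q) = ofPath ((Path.ofArrow Q a).comp
    (Path.ofArrow Q b) h) := ofPath_mul_ofPath _ _ _
  rw [hmul, ofPath_mem_span_arrow_mul_arrow_iff hR]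
  simp [Path.ofArrow]

end PathAlgebra

end GentleAlg

/-! ### Projective dimension of modules -/

namespace GentleAlg

section Homological

variable {R : Type u} [Ring R]
variable {M M₁ M₂ M₃ : Type u} [AddCommGroup M] [Module R M] [AddCommGroup M₁] [Module R M₁]
  [AddCommGroup M₂] [Module R M₂] [AddCommGroup M₃] [Module R M₃]

variable (R M) in
/-- The module `M` has projective dimension less than `n`. -/
abbrev PdLT (n : ℕ) : Prop := HasProjectiveDimensionLT (ModuleCat.of R M) n

theorem shortExact_of_exact {f : M₁ →ₗ[R] M₂} {g : M₂ →ₗ[R] M₃} (hf : Function.Injective f)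
    (hg : Function.Surjective g) (hfg : Function.Exact f g) :
    (ShortComplex.mk (ModuleCat.ofHom f) (ModuleCat.ofHom g) (by
      ext x; exact hfg.apply_apply_eq_zero x)).ShortExact :=
  ShortComplex.ShortExact.mk'
    ((ShortComplex.ShortExact.moduleCat_exact_iff_function_exact _).2 hfg)
    ((ModuleCat.mono_iff_injective _).2 hf) ((ModuleCat.epi_iff_surjective _).2 hg)

theorem PdLT.of_equiv {n : ℕ} (h : PdLT R M₁ n) (e : M₁ ≃ₗ[R] M₂) : PdLT R M₂ n :=
  hasProjectiveDimensionLT_of_iso e.toModuleIso n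

theorem pdLT_one_iff : PdLT R M 1 ↔ Module.Projective R M := by
  rw [IsProjective.iff_projective, PdLT, projective_iff_hasProjectiveDimensionLT_one]

theorem PdLT.mono {n m : ℕ} (h : PdLT R M n) (hnm : n ≤ m) : PdLT R M m :=
  hasProjectiveDimensionLT_of_ge _ n m hnm

theorem PdLT.of_subsingleton [Subsingleton M] (n : ℕ) : PdLT R M n :=
  PdLT.mono (ModuleCat.isZero_of_subsingleton _).hasProjectiveDimensionLT_zero (Nat.zero_le n)

/-- Dimension shifting: the kernel of an epimorphism from a projective module. -/
theorem PdLT.of_exact_left {f : M₁ →ₗ[R] M₂} {g : M₂ →ₗ[R] M₃} (hf : Function.Injective f)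
    (hg : Function.Surjective g) (hfg : Function.Exact f g) [Module.Projective R M₂] {n : ℕ}
    (h : PdLT R M₃ (n + 2)) : PdLT R M₁ (n + 1) :=
  (shortExact_of_exact hf hg hfg).hasProjectiveDimensionLT_X₁ (n + 1)
    ((pdLT_one_iff.2 ‹_›).mono (by lia)) h

theorem PdLT.of_exact_right {f : M₁ →ₗ[R] M₂} {g : M₂ →ₗ[R] M₃} (hf : Function.Injective f)
    (hg : Function.Surjective g) (hfg : Function.Exact f g) [Module.Projective R M₂] {n : ℕ}
    (h : PdLT R M₁ n) : PdLT R M₃ (n + 1) :=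
  (shortExact_of_exact hf hg hfg).hasProjectiveDimensionLT_X₃ n h
    ((pdLT_one_iff.2 ‹_›).mono (by lia))

theorem PdLT.of_exact_middle {f : M₁ →ₗ[R] M₂} {g : M₂ →ₗ[R] M₃} (hf : Function.Injective f)
    (hg : Function.Surjective g) (hfg : Function.Exact f g) {n : ℕ}
    (h₁ : PdLT R M₁ n) (h₃ : PdLT R M₃ n) : PdLT R M₂ n :=
  (shortExact_of_exact hf hg hfg).hasProjectiveDimensionLT_X₂ n h₁ h₃

/-- Dévissage: if every module annihilated by one of the ideals `I₁, …, I_r` has projective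
dimension less than `n`, then so does every module `M` with `I₁ ⋯ I_r M = 0`. -/
theorem PdLT.of_foldr_smul_eq_bot {n : ℕ} (l : List (Ideal R))
    (hl : ∀ I ∈ l, ∀ (N : Type u) [AddCommGroup N] [Module R N],
      (∀ c ∈ I, ∀ m : N, c • m = 0) → PdLT R N n)
    (h : l.foldr (fun I N => I • N) (⊤ : Submodule R M) = ⊥) : PdLT R M n := by
  have key : ∀ l' : List (Ideal R), (∀ I ∈ l', I ∈ l) →
      ∀ N : Submodule R M, N = l'.foldr (fun I N => I • N) ⊤ → PdLT R N n → PdLT R M n := by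
    intro l'
    induction l' with
    | nil => rintro _ _ rfl h; exact h.of_equiv Submodule.topEquiv
    | cons I l' ih =>
      rintro hI _ rfl h
      refine ih (fun K hK => hI K (List.mem_cons_of_mem _ hK)) _ rfl ?_
      rw [List.foldr_cons] at h
      set N := l'.foldr (fun I N => I • N) (⊤ : Submodule R M)
      have hle : I • N ≤ N := Submodule.smul_le_right
      refine PdLT.of_exact_middle (f := Submodule.inclusion hle)
        (g := (LinearMap.range (Submodule.inclusion hle)).mkQ)
        (Submodule.inclusion_injective hle) (Submodule.mkQ_surjective _)
        (LinearMap.exact_map_mkQ_range _) h ?_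
      refine hl I (hI I List.mem_cons_self) _ fun c hc m => ?_
      obtain ⟨x, rfl⟩ := Submodule.mkQ_surjective _ m
      rw [← map_smul, Submodule.mkQ_apply, Submodule.Quotient.mk_eq_zero]
      exact ⟨⟨c • (x : M), Submodule.smul_mem_smul hc x.2⟩, rfl⟩
  exact key l (fun _ => id) ⊥ h.symm (.of_subsingleton n)

variable (R M) in
/-- All direct sums of copies of `M` have projective dimension less than `n`. Stated for all direct
sums at once so that it applies to the layers of modules that are not finitely generated. -/
def SumPdLT (n : ℕ) : Prop := ∀ ι : Type u, PdLT R (ι →₀ M) n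

theorem SumPdLT.of_equiv {n : ℕ} (h : SumPdLT R M₁ n) (e : M₁ ≃ₗ[R] M₂) : SumPdLT R M₂ n :=
  fun ι => (h ι).of_equiv (Finsupp.mapRange.linearEquiv e)

theorem SumPdLT.mono {n m : ℕ} (h : SumPdLT R M n) (hnm : n ≤ m) : SumPdLT R M m :=
  fun ι => (h ι).mono hnm

theorem projective_finsupp (ι : Type u) [Module.Projective R M] :
    Module.Projective R (ι →₀ M) := by
  classical
  exact Module.Projective.of_equiv (finsuppLequivDFinsupp (ι := ι) (M := M) R).symm

theorem SumPdLT.of_projective [Module.Projective R M] : SumPdLT R M 1 :=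
  fun ι => pdLT_one_iff.2 (projective_finsupp ι)

theorem exact_finsupp_mapRange (ι : Type u) {f : M₁ →ₗ[R] M₂} {g : M₂ →ₗ[R] M₃}
    (hf : Function.Injective f) (hfg : Function.Exact f g) :
    Function.Exact (Finsupp.mapRange.linearMap (α := ι) f)
      (Finsupp.mapRange.linearMap (α := ι) g) := by
  intro y
  constructor
  · intro hy
    -- preimages under `f` are taken coordinatewise; finite support needs `0 ↦ 0`
    have h0 : Function.invFun f 0 = 0 := by
      conv_lhs => rw [← map_zero f]
      exact Function.leftInverse_invFun hf 0
    refine ⟨y.mapRange (Function.invFun f) h0, ?_⟩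
    ext i
    have hi : g (y i) = 0 := by simpa using DFunLike.congr_fun hy i
    simpa using Function.invFun_eq ((hfg (y i)).1 hi)
  · rintro ⟨x, rfl⟩
    ext i
    simp [hfg.apply_apply_eq_zero]

theorem SumPdLT.of_exact_right {f : M₁ →ₗ[R] M₂} {g : M₂ →ₗ[R] M₃} (hf : Function.Injective f)
    (hg : Function.Surjective g) (hfg : Function.Exact f g) [Module.Projective R M₂] {n : ℕ}
    (h : SumPdLT R M₁ n) : SumPdLT R M₃ (n + 1) := fun ι =>
  haveI := projective_finsupp (R := R) (M := M₂) ι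
  PdLT.of_exact_right (Finsupp.mapRange_injective f (map_zero f) hf)
    (Finsupp.mapRange_surjective g (map_zero g) hg) (exact_finsupp_mapRange ι hf hfg) (h ι)

theorem SumPdLT.of_exact_middle {f : M₁ →ₗ[R] M₂} {g : M₂ →ₗ[R] M₃} (hf : Function.Injective f)
    (hg : Function.Surjective g) (hfg : Function.Exact f g) {n : ℕ}
    (h₁ : SumPdLT R M₁ n) (h₃ : SumPdLT R M₃ n) : SumPdLT R M₂ n := fun ι =>
  PdLT.of_exact_middle (Finsupp.mapRange_injective f (map_zero f) hf)
    (Finsupp.mapRange_surjective g (map_zero g) hg) (exact_finsupp_mapRange ι hf hfg) (h₁ ι) (h₃ ι)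

theorem SumPdLT.sup {n : ℕ} {I J : Submodule R M} (hIJ : Disjoint I J)
    (hI : SumPdLT R I n) (hJ : SumPdLT R J n) : SumPdLT R (I ⊔ J : Submodule R M) n := by
  have hprod : SumPdLT R (I × J) n :=
    SumPdLT.of_exact_middle (f := LinearMap.inl R I J) (g := LinearMap.snd R I J)
      LinearMap.inl_injective LinearMap.snd_surjective .inl_snd hI hJ
  refine hprod.of_equiv ?_
  refine (LinearEquiv.ofInjective (I.subtype.coprod J.subtype) ?_).trans
    (LinearEquiv.ofEq _ _ ?_)
  · rw [← LinearMap.ker_eq_bot, LinearMap.ker_coprod_of_disjoint_range]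
    · simp
    · simpa using hIJ
  · rw [LinearMap.range_coprod, Submodule.range_subtype, Submodule.range_subtype]

theorem SumPdLT.bot (n : ℕ) : SumPdLT R (⊥ : Submodule R M) n := fun _ =>
  .of_subsingleton n

end Homological

end GentleAlg

/-! ### Bound quivers with quadratic monomial relations -/

namespace GentleAlg

open QuiverData (Path)

namespace BoundQuiver

variable {𝕜 : Type w} [Field 𝕜] {V : Type u} [Fintype V] {E : Type v} (B : BoundQuiver 𝕜 V E)

/-- `B.Rel a b`: the arrows `a`, `b` form a path of length two that lies in the ideal. Two arrows
that do not compose are not related, although their product is zero. -/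
def Rel (a b : E) : Prop := B.quiver.t a = B.quiver.s b ∧ B.arrowMul a b ∈ B.ideal

/-- The projection of the path algebra onto the algebra of the bound quiver. -/
noncomputable def proj : PathAlgebra 𝕜 B.quiver →ₐ[𝕜] B.Alg :=
  Ideal.Quotient.mkₐ 𝕜 B.ideal.asIdeal

/-- The class of an arrow in the algebra of the bound quiver. -/
noncomputable def arr (a : E) : B.Alg := B.proj (PathAlgebra.arrow a)

theorem idem_eq (x : V) : B.idem x = B.proj (PathAlgebra.ofPath (Path.trivial B.quiver x)) := rfl

theorem proj_surjective : Function.Surjective B.proj := Ideal.Quotient.mk_surjective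

theorem proj_eq_zero_iff (x : PathAlgebra 𝕜 B.quiver) : B.proj x = 0 ↔ x ∈ B.ideal :=
  Ideal.Quotient.eq_zero_iff_mem.trans TwoSidedIdeal.mem_asIdeal

theorem vertexCoeff_proj (e : V) (x : PathAlgebra 𝕜 B.quiver) :
    B.vertexCoeff e (B.proj x) = PathAlgebra.toFinsupp 𝕜 B.quiver x (Path.trivial B.quiver e) :=
  rfl

theorem idem_mul_idem (x : V) : B.idem x * B.idem x = B.idem x := by
  rw [idem_eq, ← map_mul, PathAlgebra.trivial_mul_trivial]

theorem idem_mul_arr (a : E) : B.idem (B.quiver.s a) * B.arr a = B.arr a := by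
  rw [idem_eq, arr, ← map_mul, PathAlgebra.trivial_mul_arrow]

theorem arr_mul_idem (a : E) : B.arr a * B.idem (B.quiver.t a) = B.arr a := by
  rw [idem_eq, arr, ← map_mul, PathAlgebra.arrow_mul_trivial]

theorem Rel.arr_mul_arr {B : BoundQuiver 𝕜 V E} {a b : E} (h : B.Rel a b) :
    B.arr a * B.arr b = 0 := by
  rw [arr, arr, ← map_mul, proj_eq_zero_iff]
  exact h.2

theorem vertexCoeff_arr (e : V) (a : E) : B.vertexCoeff e (B.arr a) = 0 := by
  rw [arr, vertexCoeff_proj]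
  exact Finsupp.single_eq_of_ne (by simp [Path.ofArrow, Path.trivial, QuiverData.Path.ext_iff])

theorem vertexCoeff_idem (e x : V) [Decidable (e = x)] :
    B.vertexCoeff e (B.idem x) = if e = x then 1 else 0 := by
  classical
  rw [idem_eq, vertexCoeff_proj]
  change (Finsupp.single (Path.trivial B.quiver x) (1 : 𝕜)) (Path.trivial B.quiver e) = _
  rw [Finsupp.single_apply]
  simp [Path.trivial, QuiverData.Path.ext_iff, eq_comm]

/-- The left ideal generated by the idempotent `e_x`. -/
noncomputable abbrev projIdeal (x : V) : Ideal B.Alg := Ideal.span {B.idem x}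

/-- The left ideal generated by an arrow. -/
noncomputable abbrev arrIdeal (a : E) : Ideal B.Alg := Ideal.span {B.arr a}

theorem mem_projIdeal_iff (x : V) (c : B.Alg) : c ∈ B.projIdeal x ↔ c * B.idem x = c := by
  rw [Ideal.mem_span_singleton']
  constructor
  · rintro ⟨d, rfl⟩
    rw [mul_assoc, idem_mul_idem]
  · exact fun h => ⟨c, h⟩

theorem projective_projIdeal (x : V) : Module.Projective B.Alg (B.projIdeal x) := by
  refine Module.Projective.of_split (B.projIdeal x).subtype
    ((LinearMap.toSpanSingleton B.Alg B.Alg (B.idem x)).codRestrict (B.projIdeal x) fun c => ?_) ?_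
  · exact Ideal.mem_span_singleton'.2 ⟨c, rfl⟩
  · ext c
    simpa using (B.mem_projIdeal_iff x c).1 c.2

theorem arrIdeal_le_projIdeal (a : E) : B.arrIdeal a ≤ B.projIdeal (B.quiver.t a) := by
  rw [Ideal.span_singleton_le_iff_mem, mem_projIdeal_iff, arr_mul_idem]

namespace IsGentle

variable {B} (hB : B.IsGentle)
include hB

/-- The ideal of a gentle pair consists of the combinations of paths that contain a relation. -/
theorem mem_ideal_iff (x : PathAlgebra 𝕜 B.quiver) :
    x ∈ B.ideal ↔ ∀ p ∈ (PathAlgebra.toFinsupp 𝕜 B.quiver x).support,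
      ¬ p.arrows.IsChain fun a b => ¬ B.Rel a b := by
  obtain ⟨R, hR, hI⟩ := hB.quadratic
  have hI' : B.ideal = TwoSidedIdeal.span
    ((fun r : E × E => (PathAlgebra.arrow r.1 * PathAlgebra.arrow r.2 : PathAlgebra 𝕜 B.quiver)) ''
      R) := hI
  have hrel : ∀ a b : E, B.Rel a b ↔ (a, b) ∈ R := by
    intro a b
    constructor
    · rintro ⟨h, hab⟩
      rw [hI'] at hab
      exact (PathAlgebra.arrow_mul_arrow_mem_span_iff hR h).1 hab
    · intro h
      refine ⟨hR _ h, ?_⟩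
      rw [hI']
      exact (PathAlgebra.arrow_mul_arrow_mem_span_iff hR (hR _ h)).2 h
  simp only [hrel]
  rw [hI']
  exact PathAlgebra.mem_span_arrow_mul_arrow_iff hR x

/-- Every element of `A e_x` is a combination of relation-free paths that end at `x`. -/
theorem exists_proj_eq {e : V} {c : B.Alg} (hc : c * B.idem e = c) :
    ∃ x, B.proj x = c ∧ ∀ p ∈ (PathAlgebra.toFinsupp 𝕜 B.quiver x).support,
      (p.arrows.IsChain fun a b => ¬ B.Rel a b) ∧ p.tgt = e := by
  classical
  obtain ⟨y, rfl⟩ := B.proj_surjective c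
  rw [idem_eq, ← map_mul] at hc
  set z := y * PathAlgebra.ofPath (Path.trivial B.quiver e) with hz
  -- omitting the paths that contain a relation does not change the class modulo the ideal
  refine ⟨(PathAlgebra.toFinsupp 𝕜 B.quiver).symm
    ((PathAlgebra.toFinsupp 𝕜 B.quiver z).filter fun p => p.arrows.IsChain fun a b => ¬ B.Rel a b),
    ?_, ?_⟩
  · rw [← hc, ← sub_eq_zero, ← map_sub, proj_eq_zero_iff, hB.mem_ideal_iff]
    intro p hp hpc
    rw [Finsupp.mem_support_iff, map_sub, LinearEquiv.apply_symm_apply, Finsupp.sub_apply,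
      Finsupp.filter_apply, if_pos hpc, sub_self] at hp
    exact hp rfl
  · intro p hp
    rw [LinearEquiv.apply_symm_apply, Finsupp.support_filter, Finset.mem_filter] at hp
    exact ⟨hp.2, PathAlgebra.tgt_of_mem_support_mul_trivial hp.1⟩

/-- The left annihilator of an arrow `a` in `A e_{s(a)}` is generated by the arrows `a'` for which
`a'a` is a relation. -/
theorem mem_span_of_mul_arr_eq_zero {a : E} {c : B.Alg} (hc : c * B.idem (B.quiver.s a) = c)
    (h : c * B.arr a = 0) : c ∈ Ideal.span (B.arr '' {a' | B.Rel a' a}) := by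
  obtain ⟨x, rfl, hx⟩ := hB.exists_proj_eq hc
  rw [arr, ← map_mul, proj_eq_zero_iff, hB.mem_ideal_iff] at h
  rw [PathAlgebra.eq_sum_ofPath x, map_sum]
  refine sum_mem fun p hp => ?_
  obtain ⟨hpc, hpt⟩ := hx p hp
  replace hpt : p.tgt = (Path.ofArrow B.quiver a).src := hpt
  rw [map_smul, Algebra.smul_def]
  refine Ideal.mul_mem_left _ _ ?_
  -- the path `pa` occurs in `xa ∈ I`, so a relation sits at its end
  have hbad := h (p.comp (Path.ofArrow B.quiver a) hpt) (by
    rw [Finsupp.mem_support_iff, PathAlgebra.toFinsupp_mul_arrow_comp]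
    exact Finsupp.mem_support_iff.1 hp)
  rw [Path.arrows_comp, List.isChain_append] at hbad
  simp only [Path.ofArrow, List.isChain_singleton, List.head?_cons, Option.mem_def,
    Option.some.injEq, forall_eq', true_and, hpc] at hbad
  push Not at hbad
  obtain ⟨a', ha', hrel⟩ := hbad
  obtain ⟨q, hq, rfl⟩ := p.exists_eq_comp_ofArrow ha'
  rw [← PathAlgebra.ofPath_mul_ofPath, map_mul]
  exact Ideal.mul_mem_left _ _ (Ideal.subset_span ⟨a', hrel, rfl⟩)

/-- The radical of `A e_x` is generated by the arrows that end at `x`. -/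
theorem mem_span_of_vertexCoeff_eq_zero {e : V} {c : B.Alg} (hc : c * B.idem e = c)
    (h : B.vertexCoeff e c = 0) : c ∈ Ideal.span (B.arr '' {a | B.quiver.t a = e}) := by
  obtain ⟨x, rfl, hx⟩ := hB.exists_proj_eq hc
  rw [vertexCoeff_proj] at h
  rw [PathAlgebra.eq_sum_ofPath x, map_sum]
  refine sum_mem fun p hp => ?_
  obtain ⟨-, hpt⟩ := hx p hp
  rw [map_smul, Algebra.smul_def]
  refine Ideal.mul_mem_left _ _ ?_
  cases hl : p.arrows.getLast? with
  | none =>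
    have hp0 := p.eq_trivial (List.getLast?_eq_none_iff.1 hl)
    rw [hp0, Path.tgt_trivial] at hpt
    rw [hpt] at hp0
    rw [hp0] at hp
    exact absurd h (Finsupp.mem_support_iff.1 hp)
  | some a =>
    have hta := p.tgt_eq_of_getLast? hl
    obtain ⟨q, hq, rfl⟩ := p.exists_eq_comp_ofArrow hl
    rw [← PathAlgebra.ofPath_mul_ofPath, map_mul]
    exact Ideal.mul_mem_left _ _ (Ideal.subset_span ⟨a, hta.symm.trans hpt, rfl⟩)

omit hB in
theorem exists_getLast?_of_mem_span {T : Set E} {c : B.Alg} (hc : c ∈ Ideal.span (B.arr '' T)) :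
    ∃ x, B.proj x = c ∧ ∀ p ∈ (PathAlgebra.toFinsupp 𝕜 B.quiver x).support,
      ∃ a ∈ T, p.arrows.getLast? = some a := by
  classical
  induction hc using Submodule.span_induction with
  | mem c hc =>
    obtain ⟨a, ha, rfl⟩ := hc
    refine ⟨_, rfl, fun p hp => ⟨a, ha, ?_⟩⟩
    obtain rfl := Finset.mem_singleton.1 (Finsupp.support_single_subset hp)
    rfl
  | zero => exact ⟨0, map_zero _, by simp⟩
  | add c d _ _ hc hd =>
    obtain ⟨x, rfl, hx⟩ := hc
    obtain ⟨y, rfl, hy⟩ := hd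
    refine ⟨x + y, map_add _ _ _, fun p hp => ?_⟩
    rw [map_add] at hp
    exact (Finset.mem_union.1 (Finsupp.support_add hp)).elim (hx p) (hy p)
  | smul c d _ hd =>
    obtain ⟨x, rfl, hx⟩ := hd
    obtain ⟨y, rfl⟩ := B.proj_surjective c
    refine ⟨y * x, map_mul _ _ _, fun p hp => ?_⟩
    obtain ⟨q, -, r, hr, h, rfl⟩ := PathAlgebra.exists_of_mem_support_mul hp
    obtain ⟨a, ha, hra⟩ := hx r hr
    exact ⟨a, ha, by simp [hra]⟩

/-- The left ideals generated by different arrows are independent: their elements are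
combinations of paths with different last arrows. -/
theorem disjoint_span_arr {S T : Set E} (hST : Disjoint S T) :
    Disjoint (Ideal.span (B.arr '' S)) (Ideal.span (B.arr '' T)) := by
  rw [Submodule.disjoint_def]
  intro c hS hT
  obtain ⟨x, rfl, hx⟩ := exists_getLast?_of_mem_span hS
  obtain ⟨y, hxy, hy⟩ := exists_getLast?_of_mem_span hT
  rw [eq_comm, ← sub_eq_zero, ← map_sub, proj_eq_zero_iff, hB.mem_ideal_iff] at hxy
  rw [proj_eq_zero_iff, hB.mem_ideal_iff]
  intro p hp
  refine hxy p ?_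
  rw [map_sub, Finsupp.mem_support_iff, Finsupp.sub_apply]
  have hpy : PathAlgebra.toFinsupp 𝕜 B.quiver y p = 0 := by
    by_contra hne
    obtain ⟨a, ha, hpa⟩ := hx p hp
    obtain ⟨b, hb, hpb⟩ := hy p (Finsupp.mem_support_iff.2 hne)
    rw [hpa, Option.some.injEq] at hpb
    exact Set.disjoint_left.1 hST ha (hpb ▸ hb)
  rw [hpy, sub_zero]
  exact Finsupp.mem_support_iff.1 hp

/-- An arrow does not lie in `aAa`, because the paths that occur there have length at least two
while no relation involves a single arrow. -/
theorem arr_mul_mul_arr_ne (a : E) (c : B.Alg) : B.arr a * c * B.arr a ≠ B.arr a := by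
  intro h
  obtain ⟨x, rfl⟩ := B.proj_surjective c
  -- the coefficient of the path `a` of length one in `axa - a` is `-1`
  have hsrc : (Path.trivial B.quiver (B.quiver.s a)).tgt = (Path.ofArrow B.quiver a).src := rfl
  have h0 : PathAlgebra.toFinsupp 𝕜 B.quiver
      (PathAlgebra.arrow a * x * PathAlgebra.arrow a - PathAlgebra.arrow a)
      ((Path.trivial B.quiver (B.quiver.s a)).comp (Path.ofArrow B.quiver a) hsrc) = -1 := by
    rw [map_sub, Finsupp.sub_apply, PathAlgebra.toFinsupp_mul_arrow_comp, ← vertexCoeff_proj,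
      map_mul, map_mul]
    have h1 : B.proj (PathAlgebra.arrow a) = B.arr a := rfl
    rw [h1, vertexCoeff_arr, zero_mul, zero_sub, neg_inj]
    exact Finsupp.single_eq_same
  rw [arr, ← map_mul, ← map_mul, ← sub_eq_zero, ← map_sub, proj_eq_zero_iff,
    hB.mem_ideal_iff] at h
  refine h _ (Finsupp.mem_support_iff.2 (h0.trans_ne (by simp))) ?_
  simp [Path.ofArrow, Path.trivial]

theorem arr_ne_zero (a : E) : B.arr a ≠ 0 := fun h =>
  hB.arr_mul_mul_arr_ne a 0 (by simp [h])

end IsGentle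

/-- The intersection of the kernels of all vertex coefficients: the ideal generated by the
arrows. -/
noncomputable def arrowIdeal : Ideal B.Alg := ⨅ x : V, RingHom.ker (B.vertexCoeff x)

theorem mem_arrowIdeal {c : B.Alg} : c ∈ B.arrowIdeal ↔ ∀ x, B.vertexCoeff x c = 0 := by
  simp [arrowIdeal, Submodule.mem_iInf, RingHom.mem_ker]

/-- The left ideal generated by the paths of length at least `k`. -/
noncomputable def pathIdeal (k : ℕ) : Ideal B.Alg :=
  Ideal.span {c | ∃ p : B.quiver.Path, k ≤ p.length ∧ B.proj (PathAlgebra.ofPath p) = c}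

theorem arrowIdeal_mul_pathIdeal_le (k : ℕ) :
    B.arrowIdeal * B.pathIdeal k ≤ B.pathIdeal (k + 1) := by
  rw [Ideal.mul_le]
  intro r hr s hs
  induction hs using Submodule.span_induction generalizing r with
  | mem s hs =>
    obtain ⟨p, hp, rfl⟩ := hs
    obtain ⟨x, rfl⟩ := B.proj_surjective r
    rw [mem_arrowIdeal] at hr
    simp only [vertexCoeff_proj] at hr
    rw [PathAlgebra.eq_sum_ofPath x, map_sum, Finset.sum_mul]
    refine sum_mem fun q hq => ?_
    rw [← map_mul, smul_mul_assoc, map_smul, Algebra.smul_def]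
    refine Ideal.mul_mem_left _ _ ?_
    by_cases h : q.tgt = p.src
    · rw [PathAlgebra.ofPath_mul_ofPath _ _ h]
      refine Ideal.subset_span ⟨_, ?_, rfl⟩
      have hq0 : q.arrows ≠ [] := fun h0 => by
        rw [q.eq_trivial h0] at hq
        exact (Finsupp.mem_support_iff.1 hq) (hr _)
      have := List.length_pos_iff.2 hq0
      simp only [QuiverData.Path.length, Path.arrows_comp, List.length_append] at hp ⊢
      lia
    · rw [PathAlgebra.ofPath_mul_ofPath_of_ne _ _ h, map_zero]
      exact zero_mem _
  | zero => simp
  | add s t _ _ hs ht => rw [mul_add]; exact add_mem (hs r hr) (ht r hr)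
  | smul c s _ hs =>
    rw [smul_eq_mul, ← mul_assoc]
    refine hs _ ?_
    rw [mem_arrowIdeal] at hr ⊢
    simp [hr]

namespace IsGentle

variable {B} (hB : B.IsGentle)
include hB

/-- The relation-free paths are linearly independent in the algebra. -/
theorem linearIndependent_paths :
    LinearIndependent 𝕜 fun p : {p : B.quiver.Path // p.arrows.IsChain fun a b => ¬ B.Rel a b} =>
      B.proj (PathAlgebra.ofPath p.1) := by
  rw [linearIndependent_iff']
  intro s g hg p hp
  simp only [← map_smul, ← map_sum] at hg
  rw [proj_eq_zero_iff, hB.mem_ideal_iff] at hg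
  by_contra hne
  refine hg p.1 ?_ p.2
  rw [Finsupp.mem_support_iff, map_sum, Finsupp.finsetSum_apply, Finset.sum_eq_single p]
  · rw [map_smul, PathAlgebra.toFinsupp_ofPath]
    simpa using hne
  · intro q _ hq
    rw [map_smul, PathAlgebra.toFinsupp_ofPath, Finsupp.smul_apply,
      Finsupp.single_eq_of_ne (fun h => hq (Subtype.ext h).symm), smul_zero]
  · exact fun h => absurd hp h

/-- Finite dimension bounds the lengths of the paths that are not zero. -/
theorem exists_pathIdeal_eq_bot : ∃ N, B.pathIdeal N = ⊥ := by
  have := hB.finiteDimensional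
  have hfin := hB.linearIndependent_paths.finite
  obtain ⟨N, hN⟩ := (Set.finite_range fun p :
    {p : B.quiver.Path // p.arrows.IsChain fun a b => ¬ B.Rel a b} => p.1.length).bddAbove
  refine ⟨N + 1, ?_⟩
  rw [pathIdeal, Ideal.span_eq_bot]
  rintro _ ⟨p, hp, rfl⟩
  rw [proj_eq_zero_iff, hB.mem_ideal_iff]
  intro q hq hc
  obtain rfl := Finset.mem_singleton.1 (Finsupp.support_single_subset hq)
  have := hN ⟨⟨q, hc⟩, rfl⟩
  simp only at this
  lia

end IsGentle

end BoundQuiver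

end GentleAlg

/-! ### Global dimension and chains of relations -/

namespace GentleAlg

namespace BoundQuiver

variable {𝕜 : Type w} [Field 𝕜] {V : Type u} [Fintype V] {E : Type v} (B : BoundQuiver 𝕜 V E)

/-- Right multiplication by an arrow `a`, from `A e_{s(a)}` onto `A a`. -/
noncomputable def mulArr (a : E) : B.projIdeal (B.quiver.s a) →ₗ[B.Alg] B.arrIdeal a :=
  ((LinearMap.toSpanSingleton B.Alg B.Alg (B.arr a)).comp
    (B.projIdeal (B.quiver.s a)).subtype).codRestrict (B.arrIdeal a) fun c =>
      Ideal.mem_span_singleton'.2 ⟨c, rfl⟩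

theorem coe_mulArr (a : E) (c : B.projIdeal (B.quiver.s a)) :
    (B.mulArr a c : B.Alg) = c * B.arr a := rfl

theorem mulArr_surjective (a : E) : Function.Surjective (B.mulArr a) := by
  rintro ⟨c, hc⟩
  obtain ⟨d, rfl⟩ := Ideal.mem_span_singleton'.1 hc
  refine ⟨⟨d * B.idem (B.quiver.s a), Ideal.mem_span_singleton'.2 ⟨d, rfl⟩⟩, ?_⟩
  ext
  rw [coe_mulArr, mul_assoc, idem_mul_arr]

variable {B}

theorem Rel.arrIdeal_le {a a' : E} (h : B.Rel a' a) :
    B.arrIdeal a' ≤ B.projIdeal (B.quiver.s a) :=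
  h.1 ▸ B.arrIdeal_le_projIdeal a'

namespace IsGentle

variable (hB : B.IsGentle)
include hB

/-- At most one arrow forms a relation with a given following arrow. -/
theorem rel_unique {a b c : E} (ha : B.Rel a c) (hb : B.Rel b c) : a = b := by
  by_contra hab
  have h := hB.left_xor a b c hab ha.1 hb.1
  exact h.elim (fun h => h.2 hb.2) (fun h => h.2 ha.2)

/-- If `a'a` is a relation then `0 → A a' → A e_{s(a)} → A a → 0` is exact. -/
theorem exact_mulArr {a a' : E} (h : B.Rel a' a) :
    Function.Exact (Submodule.inclusion h.arrIdeal_le) (B.mulArr a) := by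
  intro c
  have hset : {a' | B.Rel a' a} = {a'} :=
    Set.ext fun b => ⟨fun hb => hB.rel_unique hb h, fun hb => by rw [hb]; exact h⟩
  constructor
  · intro hc
    have hc0 : (c : B.Alg) * B.arr a = 0 := congrArg Subtype.val hc
    have hmem := hB.mem_span_of_mul_arr_eq_zero ((B.mem_projIdeal_iff _ _).1 c.2) hc0
    rw [hset, Set.image_singleton] at hmem
    exact ⟨⟨c, hmem⟩, rfl⟩
  · rintro ⟨⟨c, hc⟩, rfl⟩
    obtain ⟨d, rfl⟩ := Ideal.mem_span_singleton'.1 hc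
    ext
    rw [coe_mulArr, Submodule.coe_inclusion, mul_assoc, h.arr_mul_arr, mul_zero]
    rfl

theorem mulArr_injective {a : E} (h : ∀ a', ¬ B.Rel a' a) : Function.Injective (B.mulArr a) := by
  rw [injective_iff_map_eq_zero]
  intro c hc
  have hset : {a' | B.Rel a' a} = ∅ := Set.eq_empty_iff_forall_notMem.2 h
  have hc0 : (c : B.Alg) * B.arr a = 0 := congrArg Subtype.val hc
  have hmem := hB.mem_span_of_mul_arr_eq_zero ((B.mem_projIdeal_iff _ _).1 c.2) hc0
  rw [hset, Set.image_empty, Ideal.span_empty] at hmem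
  exact Subtype.ext hmem

/-- The left ideal `A a` has projective dimension less than `d` if `d` bounds the lengths of the
chains of relations that end with `a`. -/
theorem sumPdLT_arrIdeal (d : ℕ) (a : E)
    (h : ∀ l : List E, (l ++ [a]).IsChain B.Rel → l.length + 1 ≤ d) :
    SumPdLT B.Alg (B.arrIdeal a) d := by
  induction d generalizing a with
  | zero => exact absurd (h [] (by simp)) (by simp)
  | succ d ih =>
    have := B.projective_projIdeal (B.quiver.s a)
    by_cases ha : ∃ a', B.Rel a' a
    · obtain ⟨a', ha'⟩ := ha
      refine SumPdLT.of_exact_right (Submodule.inclusion_injective ha'.arrIdeal_le)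
        (B.mulArr_surjective a) (hB.exact_mulArr ha') (ih a' fun l hl => ?_)
      have := h (l ++ [a']) (hl.append (by simp) (by simpa using ha'))
      simpa using this
    · push Not at ha
      exact (SumPdLT.of_projective.of_equiv (LinearEquiv.ofBijective (B.mulArr a)
        ⟨hB.mulArr_injective ha, B.mulArr_surjective a⟩)).mono (by lia)

theorem sumPdLT_span_arr {d : ℕ} {T : Set E} (hT : T.Finite)
    (h : ∀ a ∈ T, SumPdLT B.Alg (B.arrIdeal a) d) :
    SumPdLT B.Alg (Ideal.span (B.arr '' T)) d := by
  induction T, hT using Set.Finite.induction_on with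
  | empty =>
    rw [Set.image_empty, Ideal.span_empty]
    exact SumPdLT.bot d
  | @insert a T ha _ ih =>
    rw [Set.image_insert_eq, Ideal.span_insert]
    refine SumPdLT.sup ?_ (h a (Set.mem_insert _ _))
      (ih fun b hb => h b (Set.mem_insert_of_mem _ hb))
    have := hB.disjoint_span_arr (Set.disjoint_singleton_left.2 ha)
    rwa [Set.image_singleton] at this

/-- The radical of `A e_x` is the kernel of the projection onto the simple module at `x`. -/
theorem exact_radical (x : V)
    (hle : Ideal.span (B.arr '' {a | B.quiver.t a = x}) ≤ B.projIdeal x) :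
    Function.Exact (Submodule.inclusion hle)
      ((RingHom.ker (B.vertexCoeff x)).mkQ ∘ₗ (B.projIdeal x).subtype) := by
  intro c
  have hker : ((RingHom.ker (B.vertexCoeff x)).mkQ ∘ₗ (B.projIdeal x).subtype) c = 0 ↔
      B.vertexCoeff x c = 0 := by
    rw [LinearMap.comp_apply, Submodule.mkQ_apply, Submodule.Quotient.mk_eq_zero]
    rfl
  rw [hker]
  constructor
  · intro h
    exact ⟨⟨c, hB.mem_span_of_vertexCoeff_eq_zero ((B.mem_projIdeal_iff _ _).1 c.2) h⟩, rfl⟩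
  · rintro ⟨⟨c, hc⟩, rfl⟩
    have : Ideal.span (B.arr '' {a | B.quiver.t a = x}) ≤ RingHom.ker (B.vertexCoeff x) := by
      rw [Ideal.span_le]
      rintro _ ⟨a, -, rfl⟩
      exact B.vertexCoeff_arr x a
    exact this hc

/-- A module on which `A` acts through the coefficient of `e_x` is a direct sum of copies of the
simple module at `x`. -/
theorem pdLT_of_ker_vertexCoeff {d : ℕ} (x : V)
    (h : SumPdLT B.Alg (Ideal.span (B.arr '' {a | B.quiver.t a = x})) d)
    (N : Type (max u v w)) [AddCommGroup N] [Module B.Alg N]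
    (hN : ∀ c ∈ RingHom.ker (B.vertexCoeff x), ∀ m : N, c • m = 0) : PdLT B.Alg N (d + 1) := by
  let : Module 𝕜 N := Module.compHom N (algebraMap 𝕜 B.Alg)
  have hsmul : ∀ (c : B.Alg) (m : N), c • m = B.vertexCoeff x c • m := by
    intro c m
    have hc : c - algebraMap 𝕜 B.Alg (B.vertexCoeff x c) ∈ RingHom.ker (B.vertexCoeff x) := by
      rw [RingHom.mem_ker, map_sub, AlgHom.commutes, Algebra.algebraMap_self, RingHom.id_apply,
        sub_self]
    have := hN _ hc m
    rw [sub_smul, sub_eq_zero] at this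
    exact this
  let b := Module.Basis.ofVectorSpace 𝕜 N
  let ι := Module.Basis.ofVectorSpaceIndex 𝕜 N
  have hle : Ideal.span (B.arr '' {a | B.quiver.t a = x}) ≤ B.projIdeal x := by
    rw [Ideal.span_le]
    rintro _ ⟨a, rfl, rfl⟩
    exact B.arrIdeal_le_projIdeal a (Ideal.subset_span rfl)
  -- the projective cover of `N`: one copy of `A e_x` for each vector of a basis
  let φ : (ι →₀ B.projIdeal x) →ₗ[B.Alg] N :=
    Finsupp.lsum ℕ fun i => (LinearMap.toSpanSingleton B.Alg N (b i)).comp (B.projIdeal x).subtype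
  have hφ : ∀ f, b.repr (φ f) =
      f.mapRange (fun c : B.projIdeal x => B.vertexCoeff x (c : B.Alg)) (by simp) := by
    intro f
    induction f using Finsupp.induction_linear with
    | zero => simp
    | add f g hf hg =>
      rw [map_add, map_add, hf, hg, Finsupp.mapRange_add]
      simp
    | single i c =>
      have : φ (Finsupp.single i c) = (c : B.Alg) • b i := by simp [φ]
      rw [this, hsmul, map_smul, b.repr_self, Finsupp.mapRange_single, Finsupp.smul_single,
        smul_eq_mul, mul_one]
  have := B.projective_projIdeal x
  have := projective_finsupp (R := B.Alg) (M := B.projIdeal x) ι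
  refine PdLT.of_exact_right (f := Finsupp.mapRange.linearMap (Submodule.inclusion hle)) (g := φ)
    (Finsupp.mapRange_injective _ (map_zero _) (Submodule.inclusion_injective hle)) ?_ ?_ (h ι)
  · intro m
    refine ⟨(b.repr m).mapRange (fun r => (algebraMap 𝕜 B.Alg r) •
      (⟨B.idem x, Ideal.subset_span rfl⟩ : B.projIdeal x)) (by simp), ?_⟩
    apply b.repr.injective
    classical
    rw [hφ]
    ext i
    simp [B.vertexCoeff_idem]
  · intro f
    rw [← exact_finsupp_mapRange ι (Submodule.inclusion_injective hle) (hB.exact_radical x hle) f,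
      ← b.repr.map_eq_zero_iff, hφ, Finsupp.ext_iff, Finsupp.ext_iff]
    refine forall_congr' fun i => ?_
    rw [Finsupp.mapRange_apply, Finsupp.mapRange.linearMap_apply, Finsupp.mapRange_apply,
      LinearMap.comp_apply, Submodule.mkQ_apply, Finsupp.zero_apply, Finsupp.zero_apply,
      Submodule.Quotient.mk_eq_zero]
    rfl

/-- Chains of relations of length at most `d` force global dimension at most `d`. -/
theorem pdLT_of_forall_chain {d : ℕ}
    (h : ∀ (l : List E) (a : E), (l ++ [a]).IsChain B.Rel → l.length + 1 ≤ d)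
    (M : Type (max u v w)) [AddCommGroup M] [Module B.Alg M] : PdLT B.Alg M (d + 1) := by
  have hsimple : ∀ (x : V) (N : Type (max u v w)) [AddCommGroup N] [Module B.Alg N],
      (∀ c ∈ RingHom.ker (B.vertexCoeff x), ∀ m : N, c • m = 0) → PdLT B.Alg N (d + 1) := by
    intro x
    refine hB.pdLT_of_ker_vertexCoeff x (hB.sumPdLT_span_arr ?_ fun a _ =>
      hB.sumPdLT_arrIdeal d a fun l => h l a)
    exact Set.finite_of_encard_le_coe (k := 2) (hB.ending_le_two x)
  -- a module killed by all arrows is killed by the product of the kernels of the coefficients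
  have hsemisimple : ∀ (N : Type (max u v w)) [AddCommGroup N] [Module B.Alg N],
      (∀ c ∈ B.arrowIdeal, ∀ m : N, c • m = 0) → PdLT B.Alg N (d + 1) := by
    intro N _ _ hN
    refine PdLT.of_foldr_smul_eq_bot
      ((Finset.univ : Finset V).toList.map fun x => RingHom.ker (B.vertexCoeff x)) ?_ ?_
    · intro I hI
      obtain ⟨x, -, rfl⟩ := List.mem_map.1 hI
      exact hsimple x
    · have key : ∀ l : List V,
          (l.map fun x => RingHom.ker (B.vertexCoeff x)).foldr (fun I N => I • N)
            (⊤ : Submodule B.Alg N) ≤ (⨅ x ∈ l, RingHom.ker (B.vertexCoeff x)) •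
              (⊤ : Submodule B.Alg N) := by
        intro l
        induction l with
        | nil =>
          intro m _
          simp
        | cons x l ih =>
          rw [List.map_cons, List.foldr_cons]
          refine (Submodule.smul_mono le_rfl ih).trans ?_
          rw [← Submodule.mul_smul]
          refine Submodule.smul_mono_left ?_
          simp only [List.mem_cons, iInf_or, iInf_inf_eq, iInf_iInf_eq_left]
          exact le_inf Ideal.mul_le_left Ideal.mul_le_right
      rw [eq_bot_iff]
      refine (key _).trans ?_
      rw [Submodule.smul_le]
      intro c hc m _
      rw [Submodule.mem_bot]
      refine hN c ?_ m
      simpa [arrowIdeal] using hc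
  obtain ⟨N, hN⟩ := hB.exists_pathIdeal_eq_bot
  refine PdLT.of_foldr_smul_eq_bot (List.replicate N B.arrowIdeal) ?_ ?_
  · intro I hI
    obtain rfl := List.eq_of_mem_replicate hI
    exact hsemisimple
  · have key : ∀ k : ℕ, (List.replicate k B.arrowIdeal).foldr (fun I N => I • N)
        (⊤ : Submodule B.Alg M) ≤ B.pathIdeal k • (⊤ : Submodule B.Alg M) := by
      intro k
      induction k with
      | zero =>
        intro m _
        have h1 : (1 : B.Alg) ∈ B.pathIdeal 0 := by
          rw [← map_one B.proj, PathAlgebra.eq_sum_ofPath (1 : PathAlgebra 𝕜 B.quiver), map_sum]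
          refine sum_mem fun p _ => ?_
          rw [map_smul, Algebra.smul_def]
          exact Ideal.mul_mem_left _ _ (Ideal.subset_span ⟨p, Nat.zero_le _, rfl⟩)
        simpa using Submodule.smul_mem_smul h1 (Submodule.mem_top : m ∈ (⊤ : Submodule B.Alg M))
      | succ k ih =>
        rw [List.replicate_succ, List.foldr_cons]
        refine (Submodule.smul_mono le_rfl ih).trans ?_
        rw [← Submodule.mul_smul]
        exact Submodule.smul_mono_left (B.arrowIdeal_mul_pathIdeal_le k)
    rw [eq_bot_iff]
    refine (key N).trans ?_
    rw [hN, Submodule.smul_le]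
    rintro c rfl m -
    simp

/-- The inclusion of `A a` into `A e_{t(a)}` does not split. -/
theorem not_projective_of_exact {a : E} {x : V} (hx : B.quiver.t a = x)
    {M : Type (max u v w)} [AddCommGroup M] [Module B.Alg M]
    (hle : B.arrIdeal a ≤ B.projIdeal x)
    {g : B.projIdeal x →ₗ[B.Alg] M} (hg : Function.Surjective g)
    (hexact : Function.Exact (Submodule.inclusion hle) g) : ¬ Module.Projective B.Alg M := by
  intro hM
  subst hx
  -- a section `s` of `g` gives `e - s (g e) = ca`, and multiplying by `a` yields `aca = a`
  obtain ⟨s, hs⟩ := Module.projective_lifting_property g LinearMap.id hg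
  let e : B.projIdeal (B.quiver.t a) := ⟨B.idem _, Ideal.subset_span rfl⟩
  let α : B.projIdeal (B.quiver.t a) := ⟨B.arr a, hle (Ideal.subset_span rfl)⟩
  have hα : B.arr a • e = α := Subtype.ext (B.arr_mul_idem a)
  have hgα : g α = 0 := (hexact α).2 ⟨⟨B.arr a, Ideal.subset_span rfl⟩, rfl⟩
  have hd : g (e - s (g e)) = 0 := by
    rw [map_sub, sub_eq_zero]
    exact (LinearMap.congr_fun hs (g e)).symm
  obtain ⟨⟨y, hy⟩, hye⟩ := (hexact _).1 hd
  obtain ⟨c, rfl⟩ := Ideal.mem_span_singleton'.1 hy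
  have h1 : B.arr a • (e - s (g e)) = α := by
    rw [smul_sub, ← map_smul, ← map_smul, hα, hgα, map_zero, sub_zero]
  rw [← hye] at h1
  have h2 : B.arr a * (c * B.arr a) = B.arr a := congrArg Subtype.val h1
  exact hB.arr_mul_mul_arr_ne a c (by rw [mul_assoc, h2])

/-- The projective dimension of `A a` bounds the lengths of the chains of relations that end
with `a`. -/
theorem length_le_of_pdLT_arrIdeal {d : ℕ} {l : List E} {a : E}
    (hl : (l ++ [a]).IsChain B.Rel) (h : PdLT B.Alg (B.arrIdeal a) d) : l.length + 1 ≤ d := by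
  induction d using Nat.twoStepInduction generalizing l a with
  | zero =>
    have hsub := ModuleCat.subsingleton_of_isZero ((hasProjectiveDimensionLT_zero_iff_isZero _).1 h)
    have : (⟨B.arr a, Ideal.subset_span rfl⟩ : B.arrIdeal a) = 0 := hsub.elim _ _
    exact absurd (congrArg Subtype.val this) (hB.arr_ne_zero a)
  | one =>
    obtain rfl | ⟨l, a', rfl⟩ := List.eq_nil_or_concat l
    · simp
    · rw [List.concat_eq_append, List.append_assoc, List.singleton_append,
        List.isChain_append_cons_cons] at hl
      exact absurd (pdLT_one_iff.1 h) (hB.not_projective_of_exact hl.2.1.1 hl.2.1.arrIdeal_le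
        (B.mulArr_surjective a) (hB.exact_mulArr hl.2.1))
  | more d _ ih =>
    obtain rfl | ⟨l, a', rfl⟩ := List.eq_nil_or_concat l
    · simp
    · rw [List.concat_eq_append, List.append_assoc, List.singleton_append,
        List.isChain_append_cons_cons] at hl
      have := B.projective_projIdeal (B.quiver.s a)
      have := ih hl.1 (PdLT.of_exact_left (Submodule.inclusion_injective hl.2.1.arrIdeal_le)
        (B.mulArr_surjective a) (hB.exact_mulArr hl.2.1) h)
      simpa using this

/-- Global dimension at most `n` forces chains of relations to have length at most `n`. -/
theorem length_le_of_forall_pdLT {n : ℕ}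
    (h : ∀ (M : Type (max u v w)) [AddCommGroup M] [Module B.Alg M], PdLT B.Alg M (n + 1))
    {l : List E} {a : E} (hl : (l ++ [a]).IsChain B.Rel) : l.length + 1 ≤ n := by
  have hle := B.arrIdeal_le_projIdeal a
  let X := B.projIdeal (B.quiver.t a) ⧸ LinearMap.range (Submodule.inclusion hle)
  have hX := h X
  have hexact := LinearMap.exact_map_mkQ_range (Submodule.inclusion hle)
  cases n with
  | zero =>
    exact absurd (pdLT_one_iff.1 hX)
      (hB.not_projective_of_exact rfl hle (Submodule.mkQ_surjective _) hexact)
  | succ n =>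
    have := B.projective_projIdeal (B.quiver.t a)
    exact hB.length_le_of_pdLT_arrIdeal hl (PdLT.of_exact_left
      (Submodule.inclusion_injective hle) (Submodule.mkQ_surjective _) hexact hX)

end IsGentle

end BoundQuiver

end GentleAlg

/-! ### The integral of a vertex homomorphism -/

namespace GentleAlg

namespace BoundQuiver

section Integral

variable {𝕜 : Type w} [RCLike 𝕜] {V : Type u} [Fintype V] {E : Type v} (B : BoundQuiver 𝕜 V E)

theorem integral_Icc_coord {ι : Type*} [Fintype ι] (i : ι) :
    ∫ k in Set.Icc (0 : ι → ℝ) 1, ((k i : ℝ) : 𝕜) = 1 / 2 := by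
  have hvol : (volume : Measure (ι → ℝ)).restrict (Set.Icc 0 1) =
      Measure.pi fun _ : ι => (volume : Measure ℝ).restrict (Set.Icc 0 1) := by
    rw [← Set.pi_univ_Icc, volume_pi, Measure.restrict_pi_pi]
    rfl
  have : IsProbabilityMeasure ((volume : Measure ℝ).restrict (Set.Icc 0 1)) := ⟨by simp⟩
  rw [hvol, integral_comp_eval (μ := fun _ : ι => (volume : Measure ℝ).restrict (Set.Icc 0 1))
    (f := fun x : ℝ => (x : 𝕜)) (by fun_prop), integral_ofReal, integral_Icc_eq_integral_Ioc,
    ← intervalIntegral.integral_of_le zero_le_one, integral_id]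
  norm_num [map_ofNat (algebraMap ℝ 𝕜) 2]

theorem vertexCoeff_sum_idem (q : B.quiver.Path) (k : B.sources q → ℝ) (x : B.sources q) :
    B.vertexCoeff x (∑ y : B.sources q, ((k y : ℝ) : 𝕜) • B.idem y) = k x := by
  classical
  rw [map_sum, Finset.sum_eq_single x]
  · rw [map_smul, vertexCoeff_idem, if_pos rfl, smul_eq_mul, mul_one]
  · intro y _ hy
    rw [map_smul, vertexCoeff_idem, if_neg fun h => hy (Subtype.ext h.symm), smul_zero]
  · simp

/-- Each arrow contributes the integral `1 / 2` of a coordinate over the unit cube. -/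
theorem vertexIntegral_eq (q : B.quiver.Path) : B.vertexIntegral q = (q.length : 𝕜) / 2 := by
  have key : ∀ l : List E, (∀ a ∈ l, B.quiver.s a ∈ B.sources q) →
      IntegrableOn (fun k : B.sources q → ℝ => (l.map fun a =>
        (B.vertexCoeff (B.quiver.s a)).toLinearMap).sum
          (∑ x : B.sources q, ((k x : ℝ) : 𝕜) • B.idem x)) (Set.Icc 0 1) ∧
      ∫ k in Set.Icc (0 : B.sources q → ℝ) 1, (l.map fun a =>
        (B.vertexCoeff (B.quiver.s a)).toLinearMap).sum
          (∑ x : B.sources q, ((k x : ℝ) : 𝕜) • B.idem x) = (l.length : 𝕜) / 2 := by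
    intro l
    induction l with
    | nil => intro _; simp
    | cons a l ih =>
      intro hl
      obtain ⟨h1, h2⟩ := ih fun b hb => hl b (List.mem_cons_of_mem _ hb)
      have hcoord : ∀ k : B.sources q → ℝ, B.vertexCoeff (B.quiver.s a)
          (∑ x : B.sources q, ((k x : ℝ) : 𝕜) • B.idem x) =
            k ⟨B.quiver.s a, hl a List.mem_cons_self⟩ :=
        fun k => B.vertexCoeff_sum_idem q k ⟨B.quiver.s a, hl a List.mem_cons_self⟩
      have hint : IntegrableOn (fun k : B.sources q → ℝ =>
          ((k ⟨B.quiver.s a, hl a List.mem_cons_self⟩ : ℝ) : 𝕜)) (Set.Icc 0 1) :=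
        ContinuousOn.integrableOn_compact isCompact_Icc (by fun_prop)
      simp only [List.map_cons, List.sum_cons, LinearMap.add_apply, AlgHom.toLinearMap_apply,
        hcoord]
      refine ⟨hint.add h1, ?_⟩
      rw [integral_add hint h1, h2, integral_Icc_coord, List.length_cons]
      push_cast
      ring
  refine (key q.arrows fun a ha => ?_).2
  classical
  rw [sources, List.mem_toFinset]
  exact List.mem_map_of_mem ha

end Integral

end BoundQuiver

/-! ### Threads -/

theorem isChain_imp₂ {α : Type*} {r s t : α → α → Prop} {l : List α} (hr : l.IsChain r)
    (hs : l.IsChain s) (h : ∀ a b, r a b → s a b → t a b) : l.IsChain t := by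
  rw [List.isChain_iff_forall_rel_of_append_cons_cons] at *
  exact fun _ _ _ _ hl => h _ _ (hr hl) (hs hl)

namespace QuiverData

variable {V : Type u} {E : Type v} {Q : QuiverData V E}

theorem isWalk_iff_isChain {x : V} {l : List E} :
    Q.IsWalk x l ↔ (∀ a ∈ l.head?, Q.s a = x) ∧ l.IsChain fun a b => Q.t a = Q.s b := by
  induction l generalizing x with
  | nil => simp [IsWalk]
  | cons a l ih =>
    rw [IsWalk, ih, List.isChain_cons]
    simp [eq_comm]

theorem Path.isChain (p : Q.Path) : p.arrows.IsChain fun a b => Q.t a = Q.s b :=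
  (isWalk_iff_isChain.1 p.isWalk).2

/-- A chain of maximal length, for a relation between composable arrows, is a path that cannot be
extended at either end. -/
theorem exists_maximal_path [Nonempty V] {r : E → E → Prop}
    (hr : ∀ a b, r a b → Q.t a = Q.s b) {l : List E} (hl : l.IsChain r)
    (hmax : ∀ l' : List E, l'.IsChain r → l'.length ≤ l.length) :
    ∃ p : Q.Path, p.arrows = l ∧ (∀ α, Q.s α = p.tgt → ∃ a ∈ l.getLast?, ¬ r a α) ∧
      ∀ α, Q.t α = p.src → ∃ a ∈ l.head?, ¬ r α a := by
  obtain ⟨p, rfl⟩ : ∃ p : Q.Path, p.arrows = l := by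
    cases l with
    | nil => exact ⟨Path.trivial Q (Classical.arbitrary V), rfl⟩
    | cons a l =>
      exact ⟨⟨Q.s a, a :: l, isWalk_iff_isChain.2 ⟨by simp, hl.imp fun a b => hr a b⟩⟩, rfl⟩
  refine ⟨p, rfl, fun α _ => ?_, fun α _ => ?_⟩ <;> by_contra! h
  · have := hmax (p.arrows ++ [α]) (hl.append (by simp) (by simpa using h))
    simp at this
  · have := hmax (α :: p.arrows) (List.isChain_cons.2 ⟨h, hl⟩)
    simp at this

end QuiverData

namespace BoundQuiver

section Threads

variable {𝕜 : Type w} [Field 𝕜] {V : Type u} [Fintype V] {E : Type v} (B : BoundQuiver 𝕜 V E)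

theorem IsForbiddenThread.isChain_rel {B : BoundQuiver 𝕜 V E} {p : B.quiver.Path}
    (hp : B.IsForbiddenThread p) : p.arrows.IsChain B.Rel :=
  isChain_imp₂ hp.chain p.isChain fun _ _ h h' => ⟨h', h⟩

/-- The path `βα` lies in the ideal exactly if `α^!β^!` does not lie in the dual ideal. -/
theorem koszulDual_arrowMul_mem_iff {a b : E} (h : B.quiver.t b = B.quiver.s a) :
    B.koszulDual.arrowMul a b ∈ B.koszulDual.ideal ↔ B.arrowMul b a ∉ B.ideal := by
  let R : Set (E × E) := {r | B.quiver.t r.2 = B.quiver.s r.1 ∧ B.arrowMul r.2 r.1 ∉ B.ideal}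
  have hgen : B.dualGenerators = (fun r : E × E =>
      (PathAlgebra.arrow r.1 * PathAlgebra.arrow r.2 : PathAlgebra 𝕜 B.quiver.op)) '' R := by
    ext x
    constructor
    · rintro ⟨α, β, h1, h2, rfl⟩
      exact ⟨(α, β), ⟨h1, h2⟩, rfl⟩
    · rintro ⟨⟨α, β⟩, ⟨h1, h2⟩, rfl⟩
      exact ⟨α, β, h1, h2, rfl⟩
  have hideal : B.koszulDual.ideal = TwoSidedIdeal.span ((fun r : E × E =>
      (PathAlgebra.arrow r.1 * PathAlgebra.arrow r.2 : PathAlgebra 𝕜 B.quiver.op)) '' R) := by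
    rw [← hgen]
    rfl
  rw [hideal]
  refine (PathAlgebra.arrow_mul_arrow_mem_span_iff (fun r hr => hr.1.symm) h.symm).trans ?_
  exact ⟨fun h' => h'.2, fun h' => ⟨h, h'⟩⟩

theorem isChain_rel_of_isPermittedThread_koszulDual {p : B.koszulDual.quiver.Path}
    (hp : B.koszulDual.IsPermittedThread p) : p.arrows.IsChain fun a b => B.Rel b a :=
  isChain_imp₂ hp.chain p.isChain fun a b h (h' : B.quiver.s a = B.quiver.t b) =>
    ⟨h'.symm, not_not.1 fun hn => h ((B.koszulDual_arrowMul_mem_iff h'.symm).2 hn)⟩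

/-- A chain of relations of maximal length is a forbidden thread. -/
theorem exists_isForbiddenThread [Nonempty V] {l : List E} (hl : l.IsChain B.Rel)
    (hmax : ∀ l' : List E, l'.IsChain B.Rel → l'.length ≤ l.length) :
    ∃ p, B.IsForbiddenThread p ∧ p.length = l.length := by
  obtain ⟨p, rfl, hright, hleft⟩ :=
    QuiverData.exists_maximal_path (Q := B.quiver) (fun _ _ h => h.1) hl hmax
  refine ⟨p, ⟨hl.imp fun _ _ h => h.2, fun α hα => ?_, fun α hα => ?_⟩, rfl⟩
  · obtain ⟨a, ha, hn⟩ := hright α hα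
    exact ⟨a, ha, fun h => hn ⟨by rw [← p.tgt_eq_of_getLast? ha, hα], h⟩⟩
  · obtain ⟨a, ha, hn⟩ := hleft α hα
    exact ⟨a, ha, fun h => hn ⟨by rw [← p.src_eq_of_head? ha, hα], h⟩⟩

/-- A chain of relations of maximal length, reversed, is a permitted thread of the dual. -/
theorem exists_isPermittedThread_koszulDual [Nonempty V] {l : List E} (hl : l.IsChain B.Rel)
    (hmax : ∀ l' : List E, l'.IsChain B.Rel → l'.length ≤ l.length) :
    ∃ p, B.koszulDual.IsPermittedThread p ∧ p.length = l.length := by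
  have hl' : l.reverse.IsChain fun a b => B.Rel b a := List.isChain_reverse.2 hl
  obtain ⟨p, hp, hright, hleft⟩ :=
    QuiverData.exists_maximal_path (Q := B.koszulDual.quiver) (fun _ _ h => h.1.symm) hl'
      (fun l' h' => by simpa using hmax l'.reverse (List.isChain_reverse.2 h'))
  rw [← hp] at hl' hright hleft
  refine ⟨p, ⟨hl'.imp fun a b h => ?_, fun α hα => ?_, fun α hα => ?_⟩, ?_⟩
  · rw [koszulDual_arrowMul_mem_iff _ h.1]
    exact not_not.2 h.2
  · obtain ⟨a, ha, hn⟩ := hright α hα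
    have hcomp : B.quiver.t α = B.quiver.s a := hα.trans (p.tgt_eq_of_getLast? ha)
    exact ⟨a, ha, (B.koszulDual_arrowMul_mem_iff hcomp).2 fun h => hn ⟨hcomp, h⟩⟩
  · obtain ⟨a, ha, hn⟩ := hleft α hα
    have hcomp : B.quiver.t a = B.quiver.s α := (hα.trans (p.src_eq_of_head? ha)).symm
    exact ⟨a, ha, (B.koszulDual_arrowMul_mem_iff hcomp).2 fun h => hn ⟨hcomp, h⟩⟩
  · rw [QuiverData.Path.length, hp, List.length_reverse]

/-- The global dimension of a gentle algebra, if finite, is the largest length of a chain of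
relations. -/
theorem IsGentle.exists_chain_of_globalDimension_eq {B : BoundQuiver 𝕜 V E} (hB : B.IsGentle)
    {n : ℕ} (hn : globalDimension B.Alg = n) :
    ∃ l : List E, l.IsChain B.Rel ∧ l.length = n ∧
      ∀ l' : List E, l'.IsChain B.Rel → l'.length ≤ n := by
  have hpd : ∀ (M : Type (max u v w)) [AddCommGroup M] [Module B.Alg M],
      PdLT B.Alg M (n + 1) := by
    intro M _ _
    refine (projectiveDimension_le_iff (ModuleCat.of B.Alg M) n).1 ?_
    rw [← hn]
    exact le_iSup (fun M : ModuleCat.{max u v w} B.Alg => projectiveDimension M) _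
  have hle : ∀ l' : List E, l'.IsChain B.Rel → l'.length ≤ n := by
    intro l' hl'
    obtain rfl | ⟨l, a, rfl⟩ := List.eq_nil_or_concat l'
    · simp
    · rw [List.concat_eq_append] at hl' ⊢
      simpa using hB.length_le_of_forall_pdLT hpd hl'
  -- if no chain had length `n`, then `n ≥ 1` as the empty chain exists, and all modules would
  -- have projective dimension at most `n - 1`
  by_contra! hne
  have hlt : ∀ l' : List E, l'.IsChain B.Rel → l'.length + 1 ≤ n := by
    intro l' hl'
    refine Nat.lt_of_le_of_ne (hle l' hl') fun h => ?_
    obtain ⟨l'', h1, h2⟩ := hne l' hl' h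
    exact absurd (hle l'' h1) (by lia)
  obtain ⟨m, rfl⟩ : ∃ m, n = m + 1 := ⟨n - 1, by have := hlt [] (by simp); lia⟩
  have hgl : globalDimension B.Alg ≤ (m : ℕ) := by
    refine iSup_le fun M => (projectiveDimension_le_iff M m).2 ?_
    refine hB.pdLT_of_forall_chain (fun l a hl => ?_) M
    simpa using hlt _ hl
  rw [hn] at hgl
  have : m + 1 ≤ m := by exact_mod_cast hgl
  lia

end Threads

end BoundQuiver

end GentleAlg

theorem theorem5p2 {𝕜 : Type w} [RCLike 𝕜] {V : Type u} [Fintype V] [Nonempty V] {E : Type v}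
    (B : GentleAlg.BoundQuiver 𝕜 V E) (hB : B.IsGentle)
    (n : ℕ) (hn : GentleAlg.globalDimension B.Alg = n) :
    IsLUB (B.vertexIntegral '' {F | B.IsForbiddenThread F}) ((n : 𝕜) / 2) ∧
      IsLUB (B.koszulDual.vertexIntegral '' {P | B.koszulDual.IsPermittedThread P})
        ((n : 𝕜) / 2) := by
  obtain ⟨l, hl, rfl, hmax⟩ := hB.exists_chain_of_globalDimension_eq hn
  have hhalf : ∀ {a b : ℕ}, a ≤ b → (a : 𝕜) / 2 ≤ (b : 𝕜) / 2 := by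
    intro a b hab
    have h : ((a / 2 : ℝ) : 𝕜) ≤ ((b / 2 : ℝ) : 𝕜) := RCLike.ofReal_le_ofReal.2 (by gcongr)
    rwa [RCLike.ofReal_div, RCLike.ofReal_div, RCLike.ofReal_natCast, RCLike.ofReal_natCast,
      RCLike.ofReal_ofNat] at h
  constructor <;> refine IsGreatest.isLUB ⟨?_, ?_⟩
  · obtain ⟨p, hp, hlen⟩ := B.exists_isForbiddenThread hl hmax
    exact ⟨p, hp, by rw [B.vertexIntegral_eq, hlen]⟩
  · rintro _ ⟨p, hp, rfl⟩
    rw [B.vertexIntegral_eq]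
    exact hhalf (hmax _ (GentleAlg.BoundQuiver.IsForbiddenThread.isChain_rel hp))
  · obtain ⟨p, hp, hlen⟩ := B.exists_isPermittedThread_koszulDual hl hmax
    exact ⟨p, hp, by rw [B.koszulDual.vertexIntegral_eq, hlen]⟩
  · rintro _ ⟨p, hp, rfl⟩
    rw [B.koszulDual.vertexIntegral_eq]
    refine hhalf ?_
    have := hmax _ (List.isChain_reverse.2 (B.isChain_rel_of_isPermittedThread_koszulDual hp))
    rwa [List.length_reverse] at this
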